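/- Let $k$ be a field of characteristic zero. All vector spaces are $\mathbb Z$-graded over $k$, $\epsilon(\sigma)$ denotes the Koszul sign exponent of a permutation of homogeneous elements, and all signs follow the Koszul rule. An $A_\infty$-algebra is a graded space $A$ with multilinear maps $m_n:A^{\otimes n}\to A$ ($n\ge 1$) of degree one such that $\sum_{i+s+j=n}(-1)^{|x_1|+\dots+|x_i|}m_{i+1+j}(x_1,\dots,x_i,m_s(x_{i+1},\dots,x_{i+s}),x_{i+s+1},\dots,x_n)=0$ for all $n$ and homogeneous $x_i$. A linear $A_\infty$-morphism is a degree zero linear map $f$ with $f\circ m_n=m_n'\circ f^{\otimes n}$ for all $n\ge1$. An $A_\infty$-ideal is a graded subspace $I$ with $m_n(x_1,\dots,x_n)\in I$ whenever some $x_i\in I$. An $A_\infty$-extension of $B$ by $A$ is an exact sequence $0\to A\to E\to B\to 0$ of linear $A_\infty$-morphisms; a morphism of extensions is a commutative diagram of linear $A_\infty$-morphisms between two such sequences. An open-closed homotopy algebra (OCHA) on a pair $(H_c,H_o)$ consists of graded symmetric degree one brackets $l_n$ ($n\ge1$) making $H_c$ an $L_\infty$-algebra, and degree one maps $n_{p,q}:H_c^{\wedge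 p}\otimes H_o^{\otimes q}\to H_o$ ($p+q\ge1$), such that the coderivation of the coalgebra $\Lambda^cH_c\otimes T^cH_o$ lifting $\{l_n\}$ and $\{n_{p,q}\}$ has square zero. For a graded space $V$ let $F_\infty(V)$ be the free $A_\infty$-algebra on $V$, with structure maps $\mu_n$. Given an OCHA $(H_c,H_o,\{l_n\},\{n_{p,q}\})$, let $U_\infty(H_c,H_o)$ be the quotient of $F_\infty(H_c\oplus H_o)$ by the $A_\infty$-ideal generated by the relations $$\sum_{\sigma\in S_p}(-1)^{\epsilon(\sigma)}\mu_{p+q}\bigl(\mathrm{Sh}(c_{\sigma(1)},\dots,c_{\sigma(p)}\,|\,o_1,\dots,o_q)\bigr)=n_{p,q}(c_1,\dots,c_p,o_1,\dots,o_q)\qquad(p\ge0,\ q\ge1),$$ $$\sum_{\sigma\in S_p}(-1)^{\epsilon(\sigma)}\mu_p(c_{\sigma(1)},\dots,c_{\sigma(p)})=l_p(c_1,\dots,c_p)+n_{p,0}(c_1,\dots,c_p)\qquad(p\ge1),$$ where $c_i\in H_c$, $o_j\in H_o$ and $\mathrm{Sh}$ is the signed shuffle product. Let $U_\infty(H_c)$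 be the Lada–Markl enveloping algebra of the $L_\infty$-algebra $H_c$, i.e. the quotient of $F_\infty(H_c)$ by the $A_\infty$-ideal generated by the relations $\sum_{\sigma\in S_p}(-1)^{\epsilon(\sigma)}\mu_p(c_{\sigma(1)},\dots,c_{\sigma(p)})=l_p(c_1,\dots,c_p)$, $p\ge1$. Let $\iota:H_c\oplus H_o\to U_\infty(H_c,H_o)$ and $\iota_c:H_c\to U_\infty(H_c)$ be the canonical maps, and let $\langle H_o\rangle$ be the $A_\infty$-ideal of $U_\infty(H_c,H_o)$ generated by $\iota(H_o)$. **Theorem.** (1) There is a linear $A_\infty$-morphism $P:U_\infty(H_c,H_o)\to U_\infty(H_c)$ with $P(\iota(c+o))=\iota_c(c)$ for $c\in H_c$, $o\in H_o$, and together with the inclusion it forms an $A_\infty$-extension $$0\to\langle H_o\rangle\to U_\infty(H_c,H_o)\xrightarrow{P}U_\infty(H_c)\to0 .$$ (2) Let $0\to A\xrightarrow{i}E\xrightarrow{\pi}B\to0$ be any $A_\infty$-extension, with a splitting $E=A\oplus B$ of graded vector spaces. Let $(E)_{OC}$ be the pair $(B,A)$ with the operations obtained by commutators and shuffles: $l'_n(b_1,\dots,b_n)=\sum_{\sigma\in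 S_n}(-1)^{\epsilon(\sigma)}m^B_n(b_{\sigma(1)},\dots,b_{\sigma(n)})$, and $n'_{p,q}(b_1,\dots,b_p,a_1,\dots,a_q)$ is the $A$-component of $\sum_{\sigma\in S_p}(-1)^{\epsilon(\sigma)}m^E_{p+q}(\mathrm{Sh}(b_{\sigma(1)},\dots,b_{\sigma(p)}|a_1,\dots,a_q))$. Let $f:H_c\oplus H_o\to E$ be a linear map which is a linear OCHA-morphism to $(E)_{OC}$, that is, $f(c+o)=g(c)+f_{1,0}(c)+f_{0,1}(o)$ with degree zero linear maps $g:H_c\to B$, $f_{1,0}:H_c\to A$, $f_{0,1}:H_o\to A$ such that $g\,l_n(c_1,\dots,c_n)=l'_n(g c_1,\dots,g c_n)$ for $n\ge1$ and, for homogeneous arguments, $$f_{0,1}(n_{n,0}(c_1,\dots,c_n))+f_{1,0}(l_n(c_1,\dots,c_n))=\sum_{p+q=n}\frac1{p!}\sum_{\sigma\in S_n}(-1)^{\epsilon(\sigma)}n'_{p,q}(g c_{\sigma(1)},\dots,g c_{\sigma(p)},f_{1,0}c_{\sigma(p+1)},\dots,f_{1,0}c_{\sigma(n)})\quad(n\ge1),$$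 $$f_{0,1}(n_{p,q}(c_1,\dots,c_p,o_1,\dots,o_q))=\sum_{m=0}^{p}\frac1{m!}\sum_{\sigma\in S_p}(-1)^{\epsilon(\sigma)}n'_{m,p-m+q}\bigl(g c_{\sigma(1)},\dots,g c_{\sigma(m)},\mathrm{Sh}(f_{1,0}c_{\sigma(m+1)},\dots,f_{1,0}c_{\sigma(p)}\,|\,f_{0,1}o_1,\dots,f_{0,1}o_q)\bigr)\quad(p\ge0,\ q\ge1).$$ Then there is a unique linear $A_\infty$-morphism $\varphi:U_\infty(H_c,H_o)\to E$ with $\varphi\circ\iota=f$; moreover there is a unique morphism of $A_\infty$-extensions from the extension in (1) to $0\to A\to E\to B\to0$ whose middle component $\varphi$ satisfies $\varphi\circ\iota=f$. -/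

import Mathlib

universe u v w u₁ u₂ u₃ v₁ v₂ v₃

namespace OpenClosed

/-! ### Graded vector spaces -/

/-- A `ℤ`-graded vector space: a `k`-vector space which is the internal direct sum of a family
of subspaces `deg d`, `d : ℤ`. -/
structure GradedSpace (k : Type u) [Field k] : Type (max u (v + 1)) where
  carrier : Type v
  [addCommGroup : AddCommGroup carrier]
  [module : Module k carrier]
  deg : ℤ → Submodule k carrier
  isInternal : DirectSum.IsInternal deg

instance (k : Type u) [Field k] : CoeSort (GradedSpace.{u, v} k) (Type v) :=
  ⟨GradedSpace.carrier⟩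

attribute [instance] GradedSpace.addCommGroup GradedSpace.module

section Internal

variable {k : Type u} [Field k] {M : Type v} [AddCommGroup M] [Module k M]

/-- A family of subspaces which spans and admits a compatible family of projections is a grading. -/
theorem isInternal_of_proj (G : ℤ → Submodule k M) (p : ℤ → M →ₗ[k] M)
    (hself : ∀ d, ∀ x ∈ G d, p d x = x) (hne : ∀ d e, e ≠ d → ∀ x ∈ G e, p d x = 0)
    (htop : ∀ x, x ∈ ⨆ d, G d) : DirectSum.IsInternal G := by
  classical
  apply DirectSum.isInternal_submodule_of_iSupIndep_of_iSup_eq_top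
  · rw [iSupIndep_def]
    intro d
    rw [Submodule.disjoint_def]
    intro x hx hx'
    have hle : (⨆ (j) (_ : j ≠ d), G j) ≤ LinearMap.ker (p d) :=
      iSup_le fun j => iSup_le fun hj => fun y hy => hne d j hj y hy
    have h0 : p d x = 0 := hle hx'
    rw [← hself d x hx, h0]
  · exact eq_top_iff.2 fun x _ => htop x

end Internal

namespace GradedSpace

variable {k : Type u} [Field k] (V : GradedSpace.{u, v} k)

/-- The isomorphism of a graded vector space with the direct sum of its homogeneous parts. -/
noncomputable def decompose : V ≃ₗ[k] DirectSum ℤ fun d => V.deg d :=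
  (LinearEquiv.ofBijective (DirectSum.coeLinearMap V.deg)
    (show Function.Bijective (DirectSum.coeLinearMap V.deg) from V.isInternal)).symm

/-- The homogeneous component of degree `d`. -/
noncomputable def proj (d : ℤ) : V →ₗ[k] V :=
  (V.deg d).subtype ∘ₗ DirectSum.component k ℤ (fun d => V.deg d) d ∘ₗ V.decompose.toLinearMap

theorem decompose_of_mem {d : ℤ} {x : V} (hx : x ∈ V.deg d) :
    V.decompose x = DirectSum.lof k ℤ (fun d => V.deg d) d ⟨x, hx⟩ := by
  rw [decompose, LinearEquiv.symm_apply_eq]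
  simp

theorem proj_mem (d : ℤ) (x : V) : V.proj d x ∈ V.deg d := by
  simp [proj]

theorem proj_self {d : ℤ} {x : V} (hx : x ∈ V.deg d) : V.proj d x = x := by
  simp [proj, decompose_of_mem V hx, DirectSum.component.lof_self]

theorem proj_ne {d e : ℤ} (h : e ≠ d) {x : V} (hx : x ∈ V.deg e) : V.proj d x = 0 := by
  simp [proj, decompose_of_mem V hx, DirectSum.component.of, h]

theorem iSup_deg : (⨆ d, V.deg d) = ⊤ := V.isInternal.submodule_iSup_eq_top

/-- Homogeneous elements suffice to check membership in a subspace. -/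
theorem mem_of_deg_le {N : Submodule k V} (h : ∀ d, V.deg d ≤ N) (x : V) : x ∈ N := by
  have : (⨆ d, V.deg d) ≤ N := iSup_le h
  exact this (V.iSup_deg ▸ Submodule.mem_top)

theorem mem_iSup_proj (x : V) (N : Submodule k V) (h : ∀ d, V.proj d x ∈ N) : x ∈ N := by
  classical
  have h1 : V.decompose.symm (V.decompose x) = x := V.decompose.symm_apply_apply x
  rw [← h1]
  have h2 : ∀ y : DirectSum ℤ fun d => V.deg d, V.decompose.symm y
      = ∑ i ∈ DFinsupp.support y, (y i : V) := by
    intro y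
    change DirectSum.coeLinearMap V.deg y = _
    rw [DirectSum.coeLinearMap_eq_dfinsuppSum, DFinsupp.sum]
  rw [h2]
  exact Submodule.sum_mem _ fun i _ => h i

/-- The direct sum `V ⊕ W` of graded vector spaces. -/
def prod (V : GradedSpace.{u, v} k) (W : GradedSpace.{u, w} k) : GradedSpace.{u, max v w} k where
  carrier := V × W
  deg d := (V.deg d).prod (W.deg d)
  isInternal := by
    apply isInternal_of_proj _ (fun d => (V.proj d).prodMap (W.proj d))
    · rintro d ⟨x, y⟩ ⟨hx, hy⟩
      exact Prod.ext (V.proj_self hx) (W.proj_self hy)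
    · rintro d e h ⟨x, y⟩ ⟨hx, hy⟩
      exact Prod.ext (V.proj_ne h hx) (W.proj_ne h hy)
    · rintro ⟨x, y⟩
      have h1 : x ∈ (⨆ d, (V.deg d).prod (W.deg d)).comap (LinearMap.inl k V W) :=
        V.mem_of_deg_le (fun d z hz => Submodule.mem_iSup_of_mem
          (p := fun d => (V.deg d).prod (W.deg d)) d ⟨hz, Submodule.zero_mem _⟩) x
      have h2 : y ∈ (⨆ d, (V.deg d).prod (W.deg d)).comap (LinearMap.inr k V W) :=
        W.mem_of_deg_le (fun d z hz => Submodule.mem_iSup_of_mem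
          (p := fun d => (V.deg d).prod (W.deg d)) d ⟨Submodule.zero_mem _, hz⟩) y
      have h3 : ((x, y) : V × W) = LinearMap.inl k V W x + LinearMap.inr k V W y := by simp
      rw [h3]
      exact Submodule.add_mem _ h1 h2

/-- Projection to the sum of the components whose degree has parity `e`. -/
noncomputable def parityProj (e : Fin 2) : V →ₗ[k] V :=
  DirectSum.toModule k ℤ V
    (fun d => if d % 2 = ((e : ℕ) : ℤ) then (V.deg d).subtype else 0) ∘ₗ V.decompose.toLinearMap

end GradedSpace

/-- A linear map of degree zero between graded vector spaces. -/
structure GradedHom {k : Type u} [Field k] (V : GradedSpace.{u, v} k) (W : GradedSpace.{u, w} k)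
    extends V →ₗ[k] W where
  map_deg : ∀ d, ∀ x ∈ V.deg d, toLinearMap x ∈ W.deg d

instance {k : Type u} [Field k] (V : GradedSpace.{u, v} k) (W : GradedSpace.{u, w} k) :
    CoeFun (GradedHom V W) (fun _ => V → W) := ⟨fun f => f.toLinearMap⟩

/-! ### Signs, permutations, shuffles -/

/-- The Koszul sign `(-1)^ε(σ)` of
`x₁ ⊗ ⋯ ⊗ xₙ ↦ (-1)^ε(σ) x_{σ(1)} ⊗ ⋯ ⊗ x_{σ(n)}`, where `xᵢ` has degree `d i`: every pair of
factors which changes its order contributes the product of its degrees. -/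
def koszul {n : ℕ} (d : Fin n → ℤ) (σ : Equiv.Perm (Fin n)) : ℤ :=
  ∏ i, ∏ j, if i < j ∧ σ j < σ i then ((d (σ i) * d (σ j)).negOnePow : ℤ) else 1

/-- The `(p, q)`-shuffles: `σ⁻¹(1) < ⋯ < σ⁻¹(p)` and `σ⁻¹(p+1) < ⋯ < σ⁻¹(p+q)`. -/
def shuffles (p q : ℕ) : Finset (Equiv.Perm (Fin (p + q))) :=
  Finset.univ.filter fun σ =>
    (∀ i j : Fin p, i < j → σ⁻¹ (Fin.castAdd q i) < σ⁻¹ (Fin.castAdd q j)) ∧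
    (∀ i j : Fin q, i < j → σ⁻¹ (Fin.natAdd p i) < σ⁻¹ (Fin.natAdd p j))

/-- The `(p, n - p)`-unshuffles: `σ(1) < ⋯ < σ(p)` and `σ(p+1) < ⋯ < σ(n)`. -/
def unshuffles (n p : ℕ) : Finset (Equiv.Perm (Fin n)) :=
  Finset.univ.filter fun σ =>
    ∀ i j : Fin n, i < j → ((j : ℕ) < p ∨ p ≤ (i : ℕ)) → σ i < σ j

section Words

variable {α : Type v} {n : ℕ}

/-- The first `p` letters of a word of length `n`. -/
def front (x : Fin n → α) (p : Fin (n + 1)) : Fin (p : ℕ) → α :=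
  fun i => x ⟨i, by omega⟩

/-- The last `n - p` letters of a word of length `n`. -/
def back (x : Fin n → α) (p : Fin (n + 1)) : Fin (n - p) → α :=
  fun i => x ⟨p + i, by omega⟩

/-- The `s` letters following the first `i` letters. -/
def block (x : Fin n → α) (s : Fin (n + 1)) (i : Fin (n - s + 1)) : Fin (s : ℕ) → α :=
  fun t => x ⟨i + t, by omega⟩

/-- Replace the `s` letters following the first `i` letters by the single letter `y`. -/
def replaceBlock (x : Fin n → α) (s : Fin (n + 1)) (i : Fin (n - s + 1)) (y : α) :
    Fin (n - s + 1) → α :=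
  fun t => if h : t < i then x ⟨t, by omega⟩
    else if h' : t = i then y else x ⟨t + s - 1, by omega⟩

/-- The sum of the degrees of the first `i` letters. -/
def degBefore (d : Fin n → ℤ) (i : ℕ) : ℤ :=
  ∑ t : Fin n, if (t : ℕ) < i then d t else 0

end Words

/-! ### Algebras with operations of degree one and their ideals -/

/-- A graded vector space with multilinear operations `op n`, of arity `n ≥ 1` and of degree one.
(The index `n = 0` carries no operation: `op 0 = 0`.) -/
structure OpAlgebra (k : Type u) [Field k] : Type (max u (v + 1)) extends
    GradedSpace.{u, v} k where
  op : (n : ℕ) → MultilinearMap k (fun _ : Fin n => carrier) carrier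
  op_zero : op 0 = 0
  op_deg : ∀ (n : ℕ) (d : Fin n → ℤ) (x : Fin n → carrier),
    (∀ i, x i ∈ deg (d i)) → op n x ∈ deg (∑ i, d i + 1)

namespace OpAlgebra

variable {k : Type u} [Field k] (M : OpAlgebra.{u, v} k)

/-- The left-hand side of the `A∞`-relation of arity `n` at `x₁, …, xₙ`, with `xᵢ` homogeneous of
degree `d i`:
`∑ (-1)^(|x₁| + ⋯ + |xᵢ|) m_{n-s+1}(x₁, …, xᵢ, m_s(x_{i+1}, …, x_{i+s}), x_{i+s+1}, …, xₙ)`. -/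
def ainfRel {n : ℕ} (d : Fin n → ℤ) (x : Fin n → M.carrier) : M.carrier :=
  ∑ s : Fin (n + 1), ∑ i : Fin (n - s + 1),
    ((degBefore d i).negOnePow : ℤ) • M.op (n - s + 1) (replaceBlock x s i (M.op s (block x s i)))

/-- An ideal: a graded subspace `I` such that an operation takes values in `I` as soon as one of
its arguments lies in `I`. -/
structure IsIdeal (I : Submodule k M.carrier) : Prop where
  proj_mem : ∀ x ∈ I, ∀ d, M.toGradedSpace.proj d x ∈ I
  op_mem : ∀ (n : ℕ) (x : Fin n → M.carrier) (i : Fin n), x i ∈ I → M.op n x ∈ I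

/-- The ideal generated by a set. -/
def idealSpan (S : Set M.carrier) : Submodule k M.carrier :=
  sInf {I | M.IsIdeal I ∧ S ⊆ I}

theorem idealSpan_isIdeal (S : Set M.carrier) : M.IsIdeal (M.idealSpan S) where
  proj_mem x hx d := by
    simp only [idealSpan, Submodule.mem_sInf, Set.mem_ofPred_eq] at hx ⊢
    exact fun I hI => hI.1.proj_mem x (hx I hI) d
  op_mem n x i hx := by
    simp only [idealSpan, Submodule.mem_sInf, Set.mem_ofPred_eq] at hx ⊢
    exact fun I hI => hI.1.op_mem n x i (hx I hI)

theorem subset_idealSpan (S : Set M.carrier) : S ⊆ M.idealSpan S := by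
  intro x hx
  simp only [idealSpan, SetLike.mem_coe, Submodule.mem_sInf, Set.mem_ofPred_eq]
  exact fun I hI => hI.2 hx

variable {M} {I : Submodule k M.carrier}

theorem IsIdeal.op_sub_mem (hI : M.IsIdeal I) (n : ℕ) (x y : Fin n → M.carrier)
    (h : ∀ i, x i - y i ∈ I) : M.op n x - M.op n y ∈ I := by
  classical
  have key : ∀ s : Finset (Fin n), M.op n (s.piecewise x y) - M.op n y ∈ I := by
    intro s
    induction s using Finset.induction_on with
    | empty => simp
    | insert a s ha ih =>
      have h1 : (insert a s).piecewise x y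
          = Function.update (s.piecewise x y) a (x a) := Finset.piecewise_insert _ _ _ _
      have h2 : s.piecewise x y = Function.update (s.piecewise x y) a (y a) := by
        conv_lhs => rw [← Function.update_eq_self a (s.piecewise x y)]
        simp [ha]
      have h3 : M.op n ((insert a s).piecewise x y) - M.op n (s.piecewise x y) ∈ I := by
        have h4 : M.op n (s.piecewise x y) = M.op n (Function.update (s.piecewise x y) a (y a)) :=
          congrArg _ h2
        rw [h1, h4, ← MultilinearMap.map_update_sub]
        exact hI.op_mem n _ a (by simpa using h a)
      have := Submodule.add_mem _ h3 ih
      simpa using this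
  simpa using key Finset.univ

/-- The operations of the quotient. -/
noncomputable def IsIdeal.quotientOp (hI : M.IsIdeal I) (n : ℕ) :
    MultilinearMap k (fun _ : Fin n => M.carrier ⧸ I) (M.carrier ⧸ I) :=
  have key : ∀ x y : Fin n → M.carrier, (∀ i, I.mkQ (x i) = I.mkQ (y i)) →
      I.mkQ (M.op n x) = I.mkQ (M.op n y) := fun x y h =>
    (Submodule.Quotient.eq I).2 (hI.op_sub_mem n x y fun i => (Submodule.Quotient.eq I).1 (h i))
  have hout : ∀ z : M.carrier ⧸ I, I.mkQ (Quotient.out z) = z := fun z => Quotient.out_eq' z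
  { toFun := fun x => I.mkQ (M.op n fun i => Quotient.out (x i))
    map_update_add' := by
      intro inst m i x y
      have e : inst = instDecidableEqFin n := Subsingleton.elim _ _
      subst e
      have hu : ∀ z : M.carrier ⧸ I,
          I.mkQ (M.op n fun j => Quotient.out (Function.update m i z j))
            = I.mkQ (M.op n (Function.update (fun j => Quotient.out (m j)) i (Quotient.out z))) := by
        intro z
        congr 2
        ext j
        by_cases h : j = i
        · subst h; simp
        · simp [h]
      rw [hu, hu, hu, ← map_add, ← MultilinearMap.map_update_add]
      apply key
      intro j
      by_cases h : j = i
      · subst h; simp [hout]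
      · simp [h]
    map_update_smul' := by
      intro inst m i c x
      have e : inst = instDecidableEqFin n := Subsingleton.elim _ _
      subst e
      have hu : ∀ z : M.carrier ⧸ I,
          I.mkQ (M.op n fun j => Quotient.out (Function.update m i z j))
            = I.mkQ (M.op n (Function.update (fun j => Quotient.out (m j)) i (Quotient.out z))) := by
        intro z
        congr 2
        ext j
        by_cases h : j = i
        · subst h; simp
        · simp [h]
      rw [hu, hu, ← map_smul, ← MultilinearMap.map_update_smul]
      apply key
      intro j
      by_cases h : j = i
      · subst h; simp [hout]
      · simp [h] }

theorem IsIdeal.quotientOp_mkQ (hI : M.IsIdeal I) (n : ℕ) (x : Fin n → M.carrier) :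
    hI.quotientOp n (fun i => I.mkQ (x i)) = I.mkQ (M.op n x) :=
  (Submodule.Quotient.eq I).2 (hI.op_sub_mem n _ _ fun i =>
    (Submodule.Quotient.eq I).1 (Quotient.out_eq' (I.mkQ (x i))))

/-- The quotient by an ideal, with the induced grading and operations. -/
noncomputable def quotient (M : OpAlgebra.{u, v} k) (I : Submodule k M.carrier)
    (hI : M.IsIdeal I) : OpAlgebra.{u, v} k where
  carrier := M.carrier ⧸ I
  deg d := (M.deg d).map I.mkQ
  isInternal := by
    apply isInternal_of_proj _
      (fun d => I.mapQ I (M.toGradedSpace.proj d) fun x hx => hI.proj_mem x hx d)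
    · rintro d _ ⟨x, hx, rfl⟩
      simp [M.toGradedSpace.proj_self hx]
    · rintro d e h _ ⟨x, hx, rfl⟩
      simp [M.toGradedSpace.proj_ne h hx]
    · intro z
      obtain ⟨x, rfl⟩ := I.mkQ_surjective z
      rw [← Submodule.map_iSup, M.toGradedSpace.iSup_deg]
      exact ⟨x, trivial, rfl⟩
  op n := hI.quotientOp n
  op_zero := by
    ext x
    have hx : x = fun i => I.mkQ ((fun i => i.elim0 : Fin 0 → M.carrier) i) :=
      funext fun i => i.elim0
    rw [hx, hI.quotientOp_mkQ, M.op_zero]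
    simp
  op_deg := by
    intro n d x hx
    choose y hy hyx using hx
    have e : x = fun i => I.mkQ (y i) := funext fun i => (hyx i).symm
    rw [e, hI.quotientOp_mkQ]
    exact ⟨_, M.op_deg n d y hy, rfl⟩

/-- The projection to the quotient by an ideal. -/
noncomputable def quotientMk (M : OpAlgebra.{u, v} k) (I : Submodule k M.carrier)
    (hI : M.IsIdeal I) : GradedHom M.toGradedSpace (M.quotient I hI).toGradedSpace where
  toLinearMap := I.mkQ
  map_deg _ x hx := ⟨x, hx, rfl⟩

theorem quotient_op (hI : M.IsIdeal I) (n : ℕ) (x : Fin n → M.carrier) :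
    (M.quotient I hI).op n (fun i => M.quotientMk I hI (x i)) = M.quotientMk I hI (M.op n x) :=
  hI.quotientOp_mkQ n x

theorem quotient_ainfRel (hI : M.IsIdeal I) {n : ℕ} (d : Fin n → ℤ) (x : Fin n → M.carrier) :
    (M.quotient I hI).ainfRel d (fun i => M.quotientMk I hI (x i))
      = M.quotientMk I hI (M.ainfRel d x) := by
  simp only [ainfRel, map_sum, map_zsmul]
  refine Finset.sum_congr rfl fun s _ => Finset.sum_congr rfl fun i _ => ?_
  congr 1
  rw [← quotient_op]
  congr 1
  ext t
  simp only [replaceBlock]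
  split_ifs
  · rfl
  · exact quotient_op hI s (block x s i)
  · rfl

theorem quotient_exists_rep (hI : M.IsIdeal I) {n : ℕ} (d : Fin n → ℤ)
    (x : Fin n → (M.quotient I hI).carrier) (hx : ∀ i, x i ∈ (M.quotient I hI).deg (d i)) :
    ∃ y : Fin n → M.carrier, (∀ i, y i ∈ M.deg (d i)) ∧ x = fun i => M.quotientMk I hI (y i) := by
  choose y hy hyx using hx
  exact ⟨y, hy, funext fun i => (hyx i).symm⟩

end OpAlgebra

/-! ### `A∞`-algebras -/

/-- An `A∞`-algebra, with structure maps `m_n = op n` of degree one. -/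
structure AInfAlgebra (k : Type u) [Field k] : Type (max u (v + 1)) extends
    OpAlgebra.{u, v} k where
  ainf : ∀ (n : ℕ) (d : Fin n → ℤ) (x : Fin n → carrier), (∀ i, x i ∈ deg (d i)) →
    toOpAlgebra.ainfRel d x = 0

namespace AInfAlgebra

variable {k : Type u} [Field k]

/-- A linear `A∞`-morphism. -/
structure Hom (A : AInfAlgebra.{u, v} k) (B : AInfAlgebra.{u, w} k) extends
    GradedHom A.toGradedSpace B.toGradedSpace where
  map_op : ∀ (n : ℕ) (x : Fin n → A.carrier),
    toLinearMap (A.op n x) = B.op n fun i => toLinearMap (x i)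

instance (A : AInfAlgebra.{u, v} k) (B : AInfAlgebra.{u, w} k) :
    CoeFun (Hom A B) (fun _ => A.carrier → B.carrier) := ⟨fun f => f.toLinearMap⟩

variable (A : AInfAlgebra.{u, v} k) {I : Submodule k A.carrier}

/-- The quotient of an `A∞`-algebra by an `A∞`-ideal. -/
noncomputable def quotient (I : Submodule k A.carrier) (hI : A.IsIdeal I) :
    AInfAlgebra.{u, v} k where
  toOpAlgebra := A.toOpAlgebra.quotient I hI
  ainf := by
    intro n d x hx
    obtain ⟨y, hy, rfl⟩ := OpAlgebra.quotient_exists_rep hI d x hx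
    rw [OpAlgebra.quotient_ainfRel hI d y, A.ainf n d y hy, map_zero]

/-- The projection to the quotient by an `A∞`-ideal. -/
noncomputable def quotientHom (I : Submodule k A.carrier) (hI : A.IsIdeal I) :
    Hom A (A.quotient I hI) where
  toGradedHom := A.quotientMk I hI
  map_op n x := (OpAlgebra.quotient_op hI n x).symm

/-- The operations of an `A∞`-ideal. -/
noncomputable def idealOp (hI : A.IsIdeal I) (n : ℕ) : MultilinearMap k (fun _ : Fin n => I) I :=
  MultilinearMap.codRestrict ((A.op n).compLinearMap fun _ => I.subtype) I (by
    intro x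
    rcases n with _ | n
    · rw [A.op_zero]
      simp
    · exact hI.op_mem _ _ 0 (x 0).2)

/-- An `A∞`-ideal, with the induced grading and operations, as an `A∞`-algebra. -/
noncomputable def ofIdeal (I : Submodule k A.carrier) (hI : A.IsIdeal I) :
    AInfAlgebra.{u, v} k where
  carrier := I
  deg d := (A.deg d).comap I.subtype
  isInternal := by
    apply isInternal_of_proj _
      (fun d => (A.toGradedSpace.proj d).restrict fun x hx => hI.proj_mem x hx d)
    · intro d x hx
      exact Subtype.ext (A.toGradedSpace.proj_self hx)
    · intro d e h x hx
      exact Subtype.ext (A.toGradedSpace.proj_ne h hx)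
    · intro x
      have h : (x : A.carrier) ∈ (⨆ d, (A.deg d).comap I.subtype).map I.subtype := by
        apply A.toGradedSpace.mem_iSup_proj
        intro d
        refine ⟨⟨_, hI.proj_mem x x.2 d⟩, ?_, rfl⟩
        exact Submodule.mem_iSup_of_mem (p := fun d => (A.deg d).comap I.subtype) d
          (A.toGradedSpace.proj_mem d x)
      obtain ⟨y, hy, hyx⟩ := h
      have : y = x := Subtype.ext hyx
      exact this ▸ hy
  op n := A.idealOp hI n
  op_zero := by
    ext x
    simp [idealOp, A.op_zero]
  op_deg := by
    intro n d x hx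
    exact A.op_deg n d (fun i => (x i : A.carrier)) hx
  ainf := by
    intro n d x hx
    apply Subtype.ext
    refine Eq.trans ?_ (A.ainf n d (fun i => (x i : A.carrier)) hx)
    simp only [OpAlgebra.ainfRel]
    rw [← Submodule.subtype_apply, map_sum]
    refine Finset.sum_congr rfl fun s _ => ?_
    rw [map_sum]
    refine Finset.sum_congr rfl fun i _ => ?_
    rw [map_zsmul]
    congr 1
    change A.op _ _ = A.op _ _
    congr 1
    ext t
    simp only [replaceBlock]
    split_ifs <;> rfl

/-- The inclusion of an `A∞`-ideal. -/
noncomputable def idealInclusion (I : Submodule k A.carrier) (hI : A.IsIdeal I) :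
    Hom (A.ofIdeal I hI) A where
  toLinearMap := I.subtype
  map_deg _ _ hx := hx
  map_op _ _ := rfl

end AInfAlgebra

section Extensions

variable {k : Type u} [Field k] {A : AInfAlgebra.{u, u₁} k} {E : AInfAlgebra.{u, u₂} k}
  {B : AInfAlgebra.{u, u₃} k} {A' : AInfAlgebra.{u, v₁} k} {E' : AInfAlgebra.{u, v₂} k}
  {B' : AInfAlgebra.{u, v₃} k}

/-- `0 → A → E → B → 0` is an `A∞`-extension of `B` by `A`: an exact sequence of linear
`A∞`-morphisms. -/
structure IsExtension (i : AInfAlgebra.Hom A E) (π : AInfAlgebra.Hom E B) : Prop where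
  injective : Function.Injective i
  exact : Function.Exact i π
  surjective : Function.Surjective π

/-- A morphism of `A∞`-extensions: linear `A∞`-morphisms making the diagram
```
0 → A  → E  → B  → 0
    ↓    ↓    ↓
0 → A' → E' → B' → 0
```
commutative. -/
structure ExtensionHom (i : AInfAlgebra.Hom A E) (π : AInfAlgebra.Hom E B)
    (i' : AInfAlgebra.Hom A' E') (π' : AInfAlgebra.Hom E' B') where
  left : AInfAlgebra.Hom A A'
  mid : AInfAlgebra.Hom E E'
  right : AInfAlgebra.Hom B B'
  comm_left : ∀ a, mid (i a) = i' (left a)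
  comm_right : ∀ e, right (π e) = π' (mid e)

/-- A splitting `E = A ⊕ B`, as graded vector spaces, of `A → E → B`. -/
structure Splitting (i : AInfAlgebra.Hom A E) (π : AInfAlgebra.Hom E B) where
  sec : GradedHom B.toGradedSpace E.toGradedSpace
  ret : GradedHom E.toGradedSpace A.toGradedSpace
  ret_incl : ∀ a, ret (i a) = a
  proj_sec : ∀ b, π (sec b) = b
  incl_ret_add_sec_proj : ∀ e, i (ret e) + sec (π e) = e

end Extensions

/-! ### `L∞`-algebras and open-closed homotopy algebras -/

section OCHA

variable {k : Type u} [Field k]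

/-- A structure of `L∞`-algebra on a graded vector space: graded symmetric brackets `l n`, `n ≥ 1`,
of degree one. (The index `n = 0` carries no operation: `l 0 = 0`.) -/
structure LInfStructure (C : GradedSpace.{u, v} k) where
  l : (n : ℕ) → MultilinearMap k (fun _ : Fin n => C) C
  l_zero : l 0 = 0
  l_deg : ∀ (n : ℕ) (d : Fin n → ℤ) (c : Fin n → C), (∀ i, c i ∈ C.deg (d i)) →
    l n c ∈ C.deg (∑ i, d i + 1)
  l_symm : ∀ (n : ℕ) (d : Fin n → ℤ) (c : Fin n → C), (∀ i, c i ∈ C.deg (d i)) →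
    ∀ σ : Equiv.Perm (Fin n), l n c = koszul d σ • l n (fun i => c (σ i))
  l_rel : ∀ (n : ℕ) (d : Fin n → ℤ) (c : Fin n → C), (∀ i, c i ∈ C.deg (d i)) →
    ∑ p : Fin (n + 1), ∑ σ ∈ unshuffles n p, koszul d σ •
      l (n - p + 1) (Fin.cons (l p (front (fun i => c (σ i)) p)) (back (fun i => c (σ i)) p)) = 0

/-- Two families of operations `l n : C^{⊗ n} → C` and `n p q : C^{⊗ p} ⊗ O^{⊗ q} → O`. -/
structure OCOperations (C : GradedSpace.{u, v} k) (O : GradedSpace.{u, w} k) where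
  l : (n : ℕ) → MultilinearMap k (fun _ : Fin n => C) C
  n : (p q : ℕ) →
    MultilinearMap k (fun _ : Fin p => C) (MultilinearMap k (fun _ : Fin q => O) O)

/-- A structure of open-closed homotopy algebra on the pair `(C, O)`: an `L∞`-structure `l` on `C`
and operations `n p q : C^{∧ p} ⊗ O^{⊗ q} → O` of degree one, `p + q ≥ 1`, such that the
coderivation of the coalgebra `Λᶜ C ⊗ Tᶜ O` which lifts `l` and `n` has square zero; `n_rel` is
the component with values in `O` of that equation. (The index `p = q = 0` carries no
operation: `n 0 0 = 0`.) -/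
structure OCHA (C : GradedSpace.{u, v} k) (O : GradedSpace.{u, w} k) extends
    LInfStructure C where
  n : (p q : ℕ) →
    MultilinearMap k (fun _ : Fin p => C) (MultilinearMap k (fun _ : Fin q => O) O)
  n_zero : n 0 0 = 0
  n_deg : ∀ (p q : ℕ) (d : Fin p → ℤ) (c : Fin p → C) (e : Fin q → ℤ) (o : Fin q → O),
    (∀ i, c i ∈ C.deg (d i)) → (∀ i, o i ∈ O.deg (e i)) →
    n p q c o ∈ O.deg (∑ i, d i + ∑ i, e i + 1)
  n_symm : ∀ (p q : ℕ) (d : Fin p → ℤ) (c : Fin p → C), (∀ i, c i ∈ C.deg (d i)) →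
    ∀ (o : Fin q → O) (σ : Equiv.Perm (Fin p)),
      n p q c o = koszul d σ • n p q (fun i => c (σ i)) o
  n_rel : ∀ (N m : ℕ) (d : Fin N → ℤ) (c : Fin N → C) (e : Fin m → ℤ) (o : Fin m → O),
    (∀ i, c i ∈ C.deg (d i)) → (∀ i, o i ∈ O.deg (e i)) →
    (∑ p : Fin (N + 1), ∑ σ ∈ unshuffles N p, koszul d σ •
      n (N - p + 1) m
        (Fin.cons (l p (front (fun i => c (σ i)) p)) (back (fun i => c (σ i)) p)) o) +
    (∑ p : Fin (N + 1), ∑ σ ∈ unshuffles N p, ∑ s : Fin (m + 1), ∑ i : Fin (m - s + 1),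
      (koszul d σ *
        ((∑ t, front (fun j => d (σ j)) p t) + degBefore e i +
          degBefore e i * ∑ t, back (fun j => d (σ j)) p t).negOnePow) •
      n p (m - s + 1) (front (fun j => c (σ j)) p)
        (replaceBlock o s i (n (N - p) s (back (fun j => c (σ j)) p) (block o s i)))) = 0

/-- The operations of an open-closed homotopy algebra. -/
def OCHA.toOperations {C : GradedSpace.{u, v} k} {O : GradedSpace.{u, w} k} (H : OCHA C O) :
    OCOperations C O := ⟨H.l, H.n⟩

/-- A linear OCHA-morphism: maps `g : C → C'`, `f₀₁ : O → O'` and `f₁₀ : C → O'` of degree zero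
whose lift to a morphism of coalgebras `Λᶜ C ⊗ Tᶜ O → Λᶜ C' ⊗ Tᶜ O'` commutes with the
coderivations given by the operations. The three equations are the components of that condition
with values in `C'`, in `O'` without open arguments, and in `O'` with open arguments. -/
structure LinearOCHAHom {C : GradedSpace.{u, u₁} k} {O : GradedSpace.{u, u₂} k}
    {C' : GradedSpace.{u, v₁} k} {O' : GradedSpace.{u, v₂} k}
    (X : OCOperations C O) (X' : OCOperations C' O') where
  g : GradedHom C C'
  f₀₁ : GradedHom O O'
  f₁₀ : GradedHom C O'
  map_l : ∀ (N : ℕ) (c : Fin N → C), 1 ≤ N → g (X.l N c) = X'.l N fun i => g (c i)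
  map_n_closed : ∀ (N : ℕ) (d : Fin N → ℤ) (c : Fin N → C), 1 ≤ N → (∀ i, c i ∈ C.deg (d i)) →
    f₀₁ (X.n N 0 c ![]) + f₁₀ (X.l N c) =
      ∑ p : Fin (N + 1), ((p : ℕ).factorial : k)⁻¹ • ∑ σ : Equiv.Perm (Fin N), koszul d σ •
        X'.n p (N - p) (front (fun i => g (c (σ i))) p) (back (fun i => f₁₀ (c (σ i))) p)
  map_n_open : ∀ (p q : ℕ) (d : Fin p → ℤ) (c : Fin p → C) (e : Fin q → ℤ) (o : Fin q → O),
    1 ≤ q → (∀ i, c i ∈ C.deg (d i)) → (∀ i, o i ∈ O.deg (e i)) →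
    f₀₁ (X.n p q c o) =
      ∑ m : Fin (p + 1), ((m : ℕ).factorial : k)⁻¹ • ∑ σ : Equiv.Perm (Fin p), koszul d σ •
        ∑ τ ∈ shuffles (p - m) q, koszul (Fin.append (back (fun i => d (σ i)) m) e) τ •
          X'.n m (p - m + q) (front (fun i => g (c (σ i))) m)
            (fun j => Fin.append (back (fun i => f₁₀ (c (σ i))) m) (fun i => f₀₁ (o i)) (τ j))

end OCHA

/-! ### Commutators and shuffles of an `A∞`-extension -/

section CommutatorsShuffles

variable {k : Type u} [Field k]

/-- The multilinear map `x₁, …, xₙ ↦ (-1)^ε(σ) M(x_{σ(1)}, …, x_{σ(n)})`. Since the sign depends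
on the parities of the `xᵢ` only, it is obtained by splitting every argument into its even and
its odd part. -/
noncomputable def permAct {V : GradedSpace.{u, v} k} {W : Type w} [AddCommGroup W] [Module k W]
    {n : ℕ} (M : MultilinearMap k (fun _ : Fin n => V) W) (σ : Equiv.Perm (Fin n)) :
    MultilinearMap k (fun _ : Fin n => V) W :=
  ∑ ε : Fin n → Fin 2, koszul (fun i => ((ε i : ℕ) : ℤ)) σ •
    (M.domDomCongr σ).compLinearMap fun i => V.parityProj (ε i)

theorem negOnePow_congr {a b a' b' : ℤ} (ha : a % 2 = a' % 2) (hb : b % 2 = b' % 2) :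
    (a * b).negOnePow = (a' * b').negOnePow := by
  rw [Int.negOnePow_eq_iff, Int.even_iff]
  exact Int.emod_eq_zero_of_dvd (Int.ModEq.mul (n := 2) ha hb).symm.dvd

theorem koszul_congr {n : ℕ} {d d' : Fin n → ℤ} (h : ∀ i, d i % 2 = d' i % 2)
    (σ : Equiv.Perm (Fin n)) : koszul d σ = koszul d' σ := by
  unfold koszul
  refine Finset.prod_congr rfl fun i _ => Finset.prod_congr rfl fun j _ => ?_
  rw [negOnePow_congr (h _) (h _)]

theorem GradedSpace.parityProj_of_mem (V : GradedSpace.{u, v} k) (e : Fin 2) {d : ℤ} {x : V}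
    (hx : x ∈ V.deg d) : V.parityProj e x = if d % 2 = ((e : ℕ) : ℤ) then x else 0 := by
  rw [parityProj, LinearMap.comp_apply]
  change DirectSum.toModule k ℤ V _ (V.decompose x) = _
  rw [V.decompose_of_mem hx, DirectSum.toModule_lof]
  split_ifs <;> rfl

/-- On homogeneous arguments, `permAct` is the signed permutation of the arguments. -/
theorem permAct_apply {V : GradedSpace.{u, v} k} {W : Type w} [AddCommGroup W] [Module k W]
    {n : ℕ} (M : MultilinearMap k (fun _ : Fin n => V) W) (σ : Equiv.Perm (Fin n))
    (d : Fin n → ℤ) (x : Fin n → V) (hx : ∀ i, x i ∈ V.deg (d i)) :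
    permAct M σ x = koszul d σ • M fun i => x (σ i) := by
  classical
  have hd : ∀ i, ∃ e : Fin 2, d i % 2 = ((e : ℕ) : ℤ) := fun i => by
    rcases Int.emod_two_eq_zero_or_one (d i) with h | h
    · exact ⟨0, by simpa using h⟩
    · exact ⟨1, by simpa using h⟩
  choose ε hε using hd
  rw [permAct, sum_apply, Finset.sum_eq_single ε]
  · have h1 : koszul (fun i => ((ε i : ℕ) : ℤ)) σ = koszul d σ :=
      koszul_congr (fun i => by rw [← hε, Int.emod_emod_of_dvd _ (dvd_refl 2)]) σ
    rw [h1, smul_apply]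
    congr 1
    simp only [MultilinearMap.compLinearMap_apply, MultilinearMap.domDomCongr_apply]
    congr 1
    ext i
    rw [V.parityProj_of_mem _ (hx _), if_pos (hε _)]
  · intro ε' _ hne
    obtain ⟨i, hi⟩ := Function.ne_iff.1 hne
    rw [smul_apply, MultilinearMap.compLinearMap_apply,
      MultilinearMap.domDomCongr_apply]
    rw [M.map_coord_zero (σ⁻¹ i), smul_zero]
    have hσ : σ (σ⁻¹ i) = i := σ.apply_symm_apply i
    rw [hσ, V.parityProj_of_mem _ (hx _), if_neg]
    intro h
    apply hi
    rw [hε] at h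
    exact Fin.ext (by exact_mod_cast h.symm)
  · simp

/-- The symmetrization `M ∘ χ`. -/
noncomputable def symmetrize {V : GradedSpace.{u, v} k} {W : Type w} [AddCommGroup W] [Module k W]
    {n : ℕ} (M : MultilinearMap k (fun _ : Fin n => V) W) :
    MultilinearMap k (fun _ : Fin n => V) W :=
  ∑ σ : Equiv.Perm (Fin n), permAct M σ

/-- The composition `x, y ↦ M(Ξ(x ⊗ y)) = M(Sh(χ(x₁, …, x_p) | y₁, …, y_q))` of a multilinear map
with symmetrization and shuffling. -/
noncomputable def symmShuffle {V : GradedSpace.{u, v} k} {W : Type w} [AddCommGroup W] [Module k W]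
    {p q : ℕ} (M : MultilinearMap k (fun _ : Fin (p + q) => V) W) :
    MultilinearMap k (fun _ : Fin p => V) (MultilinearMap k (fun _ : Fin q => V) W) :=
  symmetrize ((∑ τ ∈ shuffles p q, permAct M τ).domDomCongr finSumFinEquiv.symm).currySum

theorem symmetrize_apply {V : GradedSpace.{u, v} k} {W : Type w} [AddCommGroup W] [Module k W]
    {n : ℕ} (M : MultilinearMap k (fun _ : Fin n => V) W)
    (d : Fin n → ℤ) (x : Fin n → V) (hx : ∀ i, x i ∈ V.deg (d i)) :
    symmetrize M x = ∑ σ : Equiv.Perm (Fin n), koszul d σ • M fun i => x (σ i) := by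
  rw [symmetrize, sum_apply]
  exact Finset.sum_congr rfl fun σ _ => permAct_apply M σ d x hx

theorem symmShuffle_apply {V : GradedSpace.{u, v} k} {W : Type w} [AddCommGroup W] [Module k W]
    {p q : ℕ} (M : MultilinearMap k (fun _ : Fin (p + q) => V) W)
    (d : Fin p → ℤ) (x : Fin p → V) (hx : ∀ i, x i ∈ V.deg (d i))
    (e : Fin q → ℤ) (y : Fin q → V) (hy : ∀ i, y i ∈ V.deg (e i)) :
    symmShuffle M x y = ∑ σ : Equiv.Perm (Fin p), koszul d σ •
      ∑ τ ∈ shuffles p q, koszul (Fin.append (fun i => d (σ i)) e) τ •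
        M fun j => Fin.append (fun i => x (σ i)) y (τ j) := by
  rw [symmShuffle, symmetrize_apply _ d x hx, sum_apply]
  refine Finset.sum_congr rfl fun σ _ => ?_
  rw [smul_apply]
  congr 1
  rw [MultilinearMap.currySum_apply, MultilinearMap.domDomCongr_apply, sum_apply]
  refine Finset.sum_congr rfl fun τ _ => ?_
  have h : (fun i => Sum.rec (fun j => x (σ j)) y (finSumFinEquiv.symm i))
      = (Fin.append (fun j => x (σ j)) y : Fin (p + q) → V) := by
    ext i
    refine Fin.addCases (fun i => ?_) (fun i => ?_) i <;> simp
  rw [← h]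
  refine permAct_apply M τ _ _ ?_
  intro i
  refine Fin.addCases (fun i => ?_) (fun i => ?_) i
  · simpa using hx _
  · simpa using hy _

variable {A : AInfAlgebra.{u, u₁} k} {E : AInfAlgebra.{u, u₂} k} {B : AInfAlgebra.{u, u₃} k}
  {i : AInfAlgebra.Hom A E} {π : AInfAlgebra.Hom E B}

/-- The operations of the OCHA `(E)_OC` on the pair `(B, A)`, obtained by commutators and shuffles
from an `A∞`-extension `E` of `B` by `A` with a splitting `E = A ⊕ B`: the brackets on `B` are the
symmetrized structure maps of `B`, and `n p q` is the component with values in `A` of `m_{p+q} ∘ Ξ`,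
where `m` is the `A∞`-structure of `E`. -/
noncomputable def Splitting.ocOperations (S : Splitting i π) :
    OCOperations B.toGradedSpace A.toGradedSpace where
  l n := symmetrize (V := B.toGradedSpace) (B.op n)
  n p q :=
    ((S.ret.toLinearMap.compMultilinearMapₗ k ∘ₗ
      MultilinearMap.compLinearMapₗ fun _ : Fin q => i.toLinearMap).compMultilinearMap
        (symmShuffle (V := E.toGradedSpace) (E.op (p + q)))).compLinearMap
      fun _ : Fin p => S.sec.toLinearMap

/-- The linear map `C ⊕ O → E = A ⊕ B` underlying a linear OCHA-morphism from `(C, O)` to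
`(E)_OC`. -/
def Splitting.total (S : Splitting i π) {C : GradedSpace.{u, v₁} k} {O : GradedSpace.{u, v₂} k}
    {X : OCOperations C O} (f : LinearOCHAHom X S.ocOperations) (x : C.prod O) : E.carrier :=
  S.sec (f.g x.1) + i (f.f₁₀ x.1 + f.f₀₁ x.2)

end CommutatorsShuffles

/-! ### Free `A∞`-algebras -/

section Free

variable {k : Type u} [Field k]

/-- Formal expressions in homogeneous elements of `V` and operations of all arities `≥ 1`:
`node n` is an operation of arity `n + 1`. -/
inductive Term (V : GradedSpace.{u, v} k) : Type v
  | leaf (d : ℤ) (x : V.deg d) : Term V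
  | node (n : ℕ) (t : Fin (n + 1) → Term V) : Term V

/-- The degree of a formal expression. -/
def Term.degree {V : GradedSpace.{u, v} k} : Term V → ℤ
  | .leaf d _ => d
  | .node _ t => ∑ i, (t i).degree + 1

open Classical in
/-- The operations on linear combinations of formal expressions: the multilinear extensions of
`Term.node`. -/
noncomputable def termOp (V : GradedSpace.{u, v} k) : (n : ℕ) →
    MultilinearMap k (fun _ : Fin n => Term V →₀ k) (Term V →₀ k)
  | 0 => 0
  | n + 1 => (Finsupp.lmapDomain k k (Term.node n) ∘ₗ
      (PiTensorProduct.ofFinsuppEquiv' (R := k) (κ := fun _ : Fin (n + 1) => Term V)).toLinearMap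
      ).compMultilinearMap (PiTensorProduct.tprod k)

theorem termOp_single (V : GradedSpace.{u, v} k) (n : ℕ) (t : Fin (n + 1) → Term V) :
    termOp V (n + 1) (fun i => Finsupp.single (t i) 1) = Finsupp.single (Term.node n t) 1 := by
  classical
  simp [termOp]

/-- Linear combinations of formal expressions. -/
noncomputable def termAlgebra (V : GradedSpace.{u, v} k) : OpAlgebra.{u, max u v} k where
  carrier := Term V →₀ k
  deg d := Finsupp.supported k k {t | t.degree = d}
  isInternal := by
    classical
    apply isInternal_of_proj _ (fun d =>
      (Finsupp.supported k k {t : Term V | t.degree = d}).subtype ∘ₗ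
        Finsupp.restrictDom k k {t : Term V | t.degree = d})
    · intro d x hx
      simp only [LinearMap.comp_apply, Submodule.subtype_apply, Finsupp.restrictDom_apply]
      rw [Finsupp.filter_eq_self_iff]
      intro t ht
      exact hx (Finsupp.mem_support_iff.2 ht)
    · intro d e h x hx
      simp only [LinearMap.comp_apply, Submodule.subtype_apply, Finsupp.restrictDom_apply]
      rw [Finsupp.filter_eq_zero_iff]
      intro t ht
      by_contra h0
      exact h ((hx (Finsupp.mem_support_iff.2 h0)).symm.trans ht)
    · intro x
      induction x using Finsupp.induction_linear with
      | zero => exact Submodule.zero_mem _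
      | add x y hx hy => exact Submodule.add_mem _ hx hy
      | single t a =>
        exact Submodule.mem_iSup_of_mem
          (p := fun d => Finsupp.supported k k {t : Term V | t.degree = d}) t.degree
          (Finsupp.single_mem_supported k a rfl)
  op n := termOp V n
  op_zero := rfl
  op_deg := by
    classical
    intro n d x hx
    rcases n with _ | n
    · exact Submodule.zero_mem _
    · intro t ht
      have ht' := Finsupp.mapDomain_support ht
      obtain ⟨s, hs, rfl⟩ := Finset.mem_image.1 ht'
      have hs' : ∀ i, x i (s i) ≠ 0 := by
        rw [Finsupp.mem_support_iff] at hs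
        have h2 : (PiTensorProduct.ofFinsuppEquiv' (R := k) (κ := fun _ : Fin (n + 1) => Term V)
          (PiTensorProduct.tprod k x)) s = ∏ i, x i (s i) :=
            PiTensorProduct.ofFinsuppEquiv'_apply_apply _ _
        have h3 : ∏ i, x i (s i) ≠ 0 := by rw [← h2]; exact hs
        exact fun i => (Finset.prod_ne_zero_iff.1 h3) i (Finset.mem_univ i)
      have h4 : ∀ i, (s i).degree = d i := fun i => hx i (Finsupp.mem_support_iff.2 (hs' i))
      simp [Term.degree, h4]

/-- The formal expression consisting of a single homogeneous element. -/
noncomputable def termLeaf (V : GradedSpace.{u, v} k) (d : ℤ) (x : V.deg d) :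
    (termAlgebra V).carrier :=
  (Finsupp.single (Term.leaf d x) 1 : Term V →₀ k)

/-- The relations of the free `A∞`-algebra: leaves are linear in their label, and the
`A∞`-relations. -/
inductive FreeRel (V : GradedSpace.{u, v} k) : Set (termAlgebra V).carrier
  | add (d : ℤ) (x y : V.deg d) : FreeRel V
      (termLeaf V d (x + y) - (termLeaf V d x + termLeaf V d y))
  | smul (d : ℤ) (a : k) (x : V.deg d) : FreeRel V
      (termLeaf V d (a • x) - a • termLeaf V d x)
  | ainf (n : ℕ) (d : Fin n → ℤ) (x : Fin n → (termAlgebra V).carrier)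
      (hx : ∀ i, x i ∈ (termAlgebra V).deg (d i)) : FreeRel V ((termAlgebra V).ainfRel d x)

/-- The free `A∞`-algebra `F∞(V)` generated by a graded vector space `V`. -/
noncomputable def freeAInf (V : GradedSpace.{u, v} k) : AInfAlgebra.{u, max u v} k where
  toOpAlgebra := (termAlgebra V).quotient _ ((termAlgebra V).idealSpan_isIdeal (FreeRel V))
  ainf := by
    intro n d x hx
    obtain ⟨y, hy, rfl⟩ := OpAlgebra.quotient_exists_rep _ d x hx
    rw [OpAlgebra.quotient_ainfRel]
    exact (Submodule.Quotient.mk_eq_zero _).2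
      ((termAlgebra V).subset_idealSpan _ (FreeRel.ainf n d y hy))

/-- The class of a linear combination of formal expressions in the free `A∞`-algebra. -/
noncomputable def freeMk (V : GradedSpace.{u, v} k) :
    GradedHom (termAlgebra V).toGradedSpace (freeAInf V).toGradedSpace :=
  (termAlgebra V).quotientMk _ ((termAlgebra V).idealSpan_isIdeal (FreeRel V))

theorem freeMk_eq {V : GradedSpace.{u, v} k} {x y : (termAlgebra V).carrier}
    (h : FreeRel V (x - y)) : freeMk V x = freeMk V y :=
  (Submodule.Quotient.eq _).2 ((termAlgebra V).subset_idealSpan _ h)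

/-- The generators of degree `d` in the free `A∞`-algebra. -/
noncomputable def freeLeaf (V : GradedSpace.{u, v} k) (d : ℤ) :
    V.deg d →ₗ[k] (freeAInf V).carrier where
  toFun x := freeMk V (termLeaf V d x)
  map_add' x y := by
    rw [← map_add]
    exact freeMk_eq (FreeRel.add d x y)
  map_smul' a x := by
    rw [RingHom.id_apply, ← map_smul]
    exact freeMk_eq (FreeRel.smul d a x)

/-- The canonical map from `V` to the free `A∞`-algebra generated by `V`. -/
noncomputable def freeι (V : GradedSpace.{u, v} k) :
    GradedHom V (freeAInf V).toGradedSpace where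
  toLinearMap := DirectSum.toModule k ℤ _ (freeLeaf V) ∘ₗ V.decompose.toLinearMap
  map_deg d x hx := by
    change DirectSum.toModule k ℤ _ (freeLeaf V) (V.decompose x) ∈ _
    rw [V.decompose_of_mem hx, DirectSum.toModule_lof]
    exact (freeMk V).map_deg d _ (Finsupp.single_mem_supported k 1 rfl)

end Free

/-! ### Universal enveloping `A∞`-algebras -/

section Envelope

variable {k : Type u} [Field k] {C : GradedSpace.{u, v} k} {O : GradedSpace.{u, w} k}

namespace LInfStructure

variable (L : LInfStructure C)

/-- The relations `∑_σ (-1)^ε(σ) μ_p(c_{σ(1)}, …, c_{σ(p)}) = l_p(c₁, …, c_p)`. -/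
inductive Rel : Set (freeAInf C).carrier
  | mk (p : ℕ) (d : Fin p → ℤ) (c : Fin p → C) (hp : 1 ≤ p) (hc : ∀ i, c i ∈ C.deg (d i)) :
      Rel (∑ σ : Equiv.Perm (Fin p), koszul d σ • (freeAInf C).op p (fun i => freeι C (c (σ i)))
        - freeι C (L.l p c))

/-- The Lada–Markl universal enveloping `A∞`-algebra `U∞(C)` of an `L∞`-algebra. -/
noncomputable def envelope : AInfAlgebra.{u, max u v} k :=
  (freeAInf C).quotient _ ((freeAInf C).idealSpan_isIdeal L.Rel)

/-- The canonical map from an `L∞`-algebra to its universal enveloping `A∞`-algebra. -/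
noncomputable def ι (c : C) : L.envelope.carrier :=
  (freeAInf C).quotientHom _ ((freeAInf C).idealSpan_isIdeal L.Rel) (freeι C c)

end LInfStructure

namespace OCHA

variable (H : OCHA C O)

/-- The relations
`∑_σ (-1)^ε(σ) μ_{p+q}(Sh(c_{σ(1)}, …, c_{σ(p)} | o₁, …, o_q)) = n_{p,q}(c₁, …, c_p, o₁, …, o_q)`
for `p ≥ 0`, `q ≥ 1`, and
`∑_σ (-1)^ε(σ) μ_p(c_{σ(1)}, …, c_{σ(p)}) = l_p(c₁, …, c_p) + n_{p,0}(c₁, …, c_p)` for `p ≥ 1`. -/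
inductive Rel : Set (freeAInf (C.prod O)).carrier
  | mixed (p q : ℕ) (d : Fin p → ℤ) (c : Fin p → C) (e : Fin q → ℤ) (o : Fin q → O)
      (hq : 1 ≤ q) (hc : ∀ i, c i ∈ C.deg (d i)) (ho : ∀ i, o i ∈ O.deg (e i)) :
      Rel (∑ σ : Equiv.Perm (Fin p), koszul d σ •
          ∑ τ ∈ shuffles p q, koszul (Fin.append (fun i => d (σ i)) e) τ •
            (freeAInf (C.prod O)).op (p + q) (fun j => freeι (C.prod O)
              (Fin.append (fun i => ((c (σ i), 0) : C × O)) (fun i => ((0, o i) : C × O)) (τ j)))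
        - freeι (C.prod O) ((0, H.n p q c o) : C × O))
  | closed (p : ℕ) (d : Fin p → ℤ) (c : Fin p → C) (hp : 1 ≤ p) (hc : ∀ i, c i ∈ C.deg (d i)) :
      Rel (∑ σ : Equiv.Perm (Fin p), koszul d σ •
          (freeAInf (C.prod O)).op p (fun i => freeι (C.prod O) ((c (σ i), 0) : C × O))
        - freeι (C.prod O) ((H.l p c, H.n p 0 c ![]) : C × O))

/-- The universal enveloping `A∞`-algebra `U∞(C, O)` of an open-closed homotopy algebra. -/
noncomputable def envelope : AInfAlgebra.{u, max u v w} k :=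
  (freeAInf (C.prod O)).quotient _ ((freeAInf (C.prod O)).idealSpan_isIdeal H.Rel)

/-- The canonical map from `C ⊕ O` to `U∞(C, O)`. -/
noncomputable def ι (x : C.prod O) : H.envelope.carrier :=
  (freeAInf (C.prod O)).quotientHom _ ((freeAInf (C.prod O)).idealSpan_isIdeal H.Rel)
    (freeι (C.prod O) x)

/-- The `A∞`-ideal `⟨O⟩` of `U∞(C, O)` generated by `O`. -/
noncomputable def openIdeal : Submodule k H.envelope.carrier :=
  H.envelope.idealSpan (Set.range fun o : O => H.ι ((0, o) : C × O))

theorem openIdeal_isIdeal : H.envelope.IsIdeal H.openIdeal :=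
  H.envelope.idealSpan_isIdeal _

/-- `⟨O⟩` as an `A∞`-algebra. -/
noncomputable def openPart : AInfAlgebra.{u, max u v w} k :=
  H.envelope.ofIdeal H.openIdeal H.openIdeal_isIdeal

/-- The inclusion `⟨O⟩ → U∞(C, O)`. -/
noncomputable def openInclusion : AInfAlgebra.Hom H.openPart H.envelope :=
  H.envelope.idealInclusion H.openIdeal H.openIdeal_isIdeal

end OCHA

end Envelope

end OpenClosed

/-! Linear `A∞`-morphisms out of `U∞(C, O)` are the degree zero maps on `C ⊕ O` that satisfy the
defining relations (`OCHA.lift`, `OCHA.envelope_hom_ext`). Both parts are checks of relations on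
generators; no explicit description of the enveloping algebras is needed.

For the extension, `c + o ↦ ι_c(c)` respects the relations: a mixed relation becomes `0 = 0`, since
every term has a zero argument, and a closed relation loses its term `n_{p,0}`. Conversely `c ↦
ι(c)` modulo `⟨O⟩` satisfies the relations of `U∞(C)`, so there is a morphism `U∞(C) → U∞(C,
O)/⟨O⟩`. Its composite with `P` agrees with the quotient map on generators, hence everywhere, and so
the kernel of `P` lies in `⟨O⟩`.

For the universal property, the relations are checked separately on the `B`- and the `A`-component
of `E`. In `B` a mixed relation is trivial and a closed one says that `g` preserves brackets. In `A`
the closed letters are sums `sec (g c) + i (f₁₀ c)`, and a symmetrized shuffle product is expanded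
over the subsets `T` of positions carrying the first summand. As `σ` runs through `S_p`, each `T` of
size `m` is the image of the first `m` positions `m! (p - m)!` times. The factor `(p - m)!` is
absorbed by the orderings of the letters `f₁₀ c`. The factor `1/m!` survives, because `n'_{m, ·}`
symmetrizes its `m` closed arguments once more. The result is the right-hand side of the
OCHA-morphism equations (`openSum_add_eq_sum_nestedShuffle`, `ret_openSum`).

The resulting `φ` maps `⟨O⟩` into `ker π = im i`, so it restricts to the left and descends along `P`
to the right. Injectivity of `i` and surjectivity of `P` make these outer maps unique. -/

namespace OpenClosed

/-! ### Maps of graded spaces and of algebras with operations -/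

section Maps

variable {k : Type u} [Field k]

theorem GradedHom.ext {V : GradedSpace.{u, v} k} {W : GradedSpace.{u, w} k} {f g : GradedHom V W}
    (h : ∀ x, f x = g x) : f = g := by
  obtain ⟨f, _⟩ := f
  obtain ⟨g, _⟩ := g
  obtain rfl : f = g := LinearMap.ext h
  rfl

theorem AInfAlgebra.Hom.ext {A : AInfAlgebra.{u, v} k} {B : AInfAlgebra.{u, w} k}
    {f g : AInfAlgebra.Hom A B} (h : ∀ x, f x = g x) : f = g := by
  obtain ⟨f, _⟩ := f
  obtain ⟨g, _⟩ := g
  obtain rfl : f = g := GradedHom.ext h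
  rfl

/-- Both sides are linear in `x`, so homogeneous `x` suffice. This makes kernels graded subspaces,
hence ideals in the sense of `IsIdeal`. -/
theorem GradedHom.map_proj {V : GradedSpace.{u, v} k} {W : GradedSpace.{u, w} k}
    (f : GradedHom V W) (d : ℤ) (x : V) : f (V.proj d x) = W.proj d (f x) := by
  refine V.mem_of_deg_le (N := LinearMap.eqLocus (f.toLinearMap ∘ₗ V.proj d)
    (W.proj d ∘ₗ f.toLinearMap)) (fun e y hy => ?_) x
  change f (V.proj d y) = W.proj d (f y)
  by_cases h : e = d
  · subst h
    rw [V.proj_self hy, W.proj_self (f.map_deg _ _ hy)]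
  · rw [V.proj_ne h hy, W.proj_ne h (f.map_deg _ _ hy), map_zero]

/-! ### Kernels, generated ideals and maps out of quotients. -/

namespace OpAlgebra

variable {M : OpAlgebra.{u, v} k} {N : OpAlgebra.{u, w} k}
  (f : GradedHom M.toGradedSpace N.toGradedSpace)

theorem op_eq_zero_of_apply_eq_zero (N : OpAlgebra.{u, w} k) {n : ℕ} (x : Fin n → N.carrier)
    (i : Fin n) (h : x i = 0) : N.op n x = 0 :=
  (N.op n).map_coord_zero i h

theorem ker_isIdeal (hf : ∀ n x, f (M.op n x) = N.op n fun i => f (x i)) :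
    M.IsIdeal (LinearMap.ker f.toLinearMap) where
  proj_mem x hx d := by
    have hx' : f x = 0 := hx
    change f _ = 0
    rw [f.map_proj, hx', map_zero]
  op_mem n x i hx := by
    change f _ = 0
    rw [hf]
    exact op_eq_zero_of_apply_eq_zero N _ i hx

theorem idealSpan_le {S : Set M.carrier} {I : Submodule k M.carrier} (hI : M.IsIdeal I)
    (h : S ⊆ I) : M.idealSpan S ≤ I :=
  sInf_le ⟨hI, h⟩

/-- Neither side is assumed to satisfy the `A∞`-relations: the lemma is applied to evaluation on
`termAlgebra V`, where they are not imposed. -/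
theorem map_ainfRel (hf : ∀ n x, f (M.op n x) = N.op n fun i => f (x i)) {n : ℕ}
    (d : Fin n → ℤ) (x : Fin n → M.carrier) :
    f (M.ainfRel d x) = N.ainfRel d fun i => f (x i) := by
  simp only [ainfRel, map_sum, map_zsmul]
  refine Finset.sum_congr rfl fun s _ => Finset.sum_congr rfl fun i _ => ?_
  congr 1
  rw [hf]
  congr 1
  ext t
  simp only [replaceBlock]
  split_ifs
  · rfl
  · exact hf s (block x s i)
  · rfl

/-- A degree zero map which vanishes on an ideal descends to the quotient. -/
noncomputable def quotientLift {I : Submodule k M.carrier} (hI : M.IsIdeal I)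
    (h : I ≤ LinearMap.ker f.toLinearMap) :
    GradedHom (M.quotient I hI).toGradedSpace N.toGradedSpace where
  toLinearMap := I.liftQ f.toLinearMap h
  map_deg := by
    rintro d _ ⟨x, hx, rfl⟩
    exact f.map_deg d x hx

theorem quotientMk_surjective {I : Submodule k M.carrier} (hI : M.IsIdeal I) :
    Function.Surjective (M.quotientMk I hI) :=
  I.mkQ_surjective

theorem quotientMk_eq_zero {I : Submodule k M.carrier} (hI : M.IsIdeal I) {x : M.carrier} :
    M.quotientMk I hI x = 0 ↔ x ∈ I :=
  Submodule.Quotient.mk_eq_zero I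

theorem quotientLift_op (hf : ∀ n x, f (M.op n x) = N.op n fun i => f (x i))
    {I : Submodule k M.carrier} (hI : M.IsIdeal I) (h : I ≤ LinearMap.ker f.toLinearMap)
    (n : ℕ) (x : Fin n → (M.quotient I hI).carrier) :
    quotientLift f hI h ((M.quotient I hI).op n x)
      = N.op n fun i => quotientLift f hI h (x i) := by
  choose y hy using fun i => quotientMk_surjective hI (x i)
  obtain rfl : (fun i => M.quotientMk I hI (y i)) = x := funext hy
  rw [quotient_op]
  exact hf n y

end OpAlgebra

/-! ### Factoring linear `A∞`-morphisms through injections and along surjections. -/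

namespace AInfAlgebra

variable {A : AInfAlgebra.{u, v} k} {B : AInfAlgebra.{u, w} k} {D : AInfAlgebra.{u, u₁} k}

/-- The composite of linear `A∞`-morphisms. -/
noncomputable def Hom.comp (g : Hom B D) (f : Hom A B) : Hom A D where
  toLinearMap := g.toLinearMap ∘ₗ f.toLinearMap
  map_deg d x hx := g.map_deg d _ (f.map_deg d x hx)
  map_op n x := by
    change g (f _) = _
    rw [f.map_op, g.map_op]
    rfl

theorem Hom.ker_isIdeal (f : Hom A B) : A.IsIdeal (LinearMap.ker f.toLinearMap) :=
  OpAlgebra.ker_isIdeal f.toGradedHom f.map_op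

/-- A linear `A∞`-morphism which vanishes on generators of an ideal descends to the quotient. -/
noncomputable def Hom.quotientLift (f : Hom A B) {S : Set A.carrier} (h : ∀ x ∈ S, f x = 0) :
    Hom (A.quotient _ (A.idealSpan_isIdeal S)) B where
  toGradedHom := OpAlgebra.quotientLift f.toGradedHom (A.idealSpan_isIdeal S)
    (OpAlgebra.idealSpan_le f.ker_isIdeal h)
  map_op := OpAlgebra.quotientLift_op f.toGradedHom f.map_op _ _

/-- A linear `A∞`-morphism which takes values in the image of an injective one factors
through it. -/
noncomputable def Hom.factor (i : Hom B D) (hi : Function.Injective i) (f : Hom A D)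
    (h : ∀ a, ∃ b, i b = f a) (hdeg : ∀ d b, i b ∈ D.deg d → b ∈ B.deg d) : Hom A B where
  toLinearMap := (LinearEquiv.ofInjective i.toLinearMap hi).symm.toLinearMap ∘ₗ
    f.toLinearMap.codRestrict (LinearMap.range i.toLinearMap) h
  map_deg d x hx := by
    apply hdeg
    have e : ∀ y, i ((LinearEquiv.ofInjective i.toLinearMap hi).symm y) = y := fun y =>
      congrArg Subtype.val ((LinearEquiv.ofInjective i.toLinearMap hi).apply_symm_apply y)
    change i ((LinearEquiv.ofInjective i.toLinearMap hi).symm _) ∈ _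
    rw [e]
    exact f.map_deg d x hx
  map_op n x := by
    have e : ∀ y, i ((LinearEquiv.ofInjective i.toLinearMap hi).symm y) = y := fun y =>
      congrArg Subtype.val ((LinearEquiv.ofInjective i.toLinearMap hi).apply_symm_apply y)
    apply hi
    refine (e _).trans ((f.map_op n x).trans ?_)
    refine Eq.trans ?_ (i.map_op n _).symm
    congr 1
    ext j
    exact (e (f.toLinearMap.codRestrict (LinearMap.range i.toLinearMap) h (x j))).symm

theorem Hom.factor_spec (i : Hom B D) (hi : Function.Injective i) (f : Hom A D)
    (h : ∀ a, ∃ b, i b = f a) (hdeg : ∀ d b, i b ∈ D.deg d → b ∈ B.deg d) (a : A.carrier) :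
    i (Hom.factor i hi f h hdeg a) = f a :=
  congrArg Subtype.val ((LinearEquiv.ofInjective i.toLinearMap hi).apply_symm_apply _)

/-- A linear `A∞`-morphism which vanishes on the kernel of a surjective one descends along it. -/
noncomputable def Hom.descend (p : Hom A B) (hp : Function.Surjective p) (f : Hom A D)
    (h : ∀ a, p a = 0 → f a = 0) : Hom B D where
  toLinearMap := (LinearMap.ker p.toLinearMap).liftQ f.toLinearMap h ∘ₗ
    (p.toLinearMap.quotKerEquivOfSurjective hp).symm.toLinearMap
  map_deg d y hy := by
    obtain ⟨x, rfl⟩ := hp y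
    -- A preimage of a homogeneous `y` need not be homogeneous, but its component of degree `d` is
    -- again a preimage.
    have hx : p x = p (A.proj d x) := by
      rw [p.map_proj, B.proj_self hy]
    have e : (p.toLinearMap.quotKerEquivOfSurjective hp).symm
        (p (A.proj d x)) = Submodule.Quotient.mk (A.proj d x) :=
      (LinearEquiv.symm_apply_eq _).2 rfl
    rw [hx, LinearMap.comp_apply, LinearEquiv.coe_coe, e]
    exact f.map_deg d _ (A.proj_mem d x)
  map_op n y := by
    have e : ∀ x, (p.toLinearMap.quotKerEquivOfSurjective hp).symm
        (p x) = Submodule.Quotient.mk x := fun x => (LinearEquiv.symm_apply_eq _).2 rfl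
    choose x hx using fun j => hp (y j)
    obtain rfl : (fun j => p (x j)) = y := funext hx
    have e' : B.op n (fun j => p (x j)) = p (A.op n x) := (p.map_op n x).symm
    rw [e', LinearMap.comp_apply, LinearEquiv.coe_coe, e]
    refine (f.map_op n x).trans ?_
    congr 1
    ext j
    rw [LinearMap.comp_apply, LinearEquiv.coe_coe, e]
    rfl

theorem Hom.descend_apply (p : Hom A B) (hp : Function.Surjective p) (f : Hom A D)
    (h : ∀ a, p a = 0 → f a = 0) (a : A.carrier) : Hom.descend p hp f h (p a) = f a := by
  have e : (p.toLinearMap.quotKerEquivOfSurjective hp).symm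
      (p a) = Submodule.Quotient.mk a := (LinearEquiv.symm_apply_eq _).2 rfl
  change (LinearMap.ker p.toLinearMap).liftQ f.toLinearMap h
    ((p.toLinearMap.quotKerEquivOfSurjective hp).symm (p a)) = _
  rw [e]
  rfl

end AInfAlgebra

/-- A degree zero map reflects homogeneity if it is injective. -/
theorem GradedHom.mem_deg_of_injective {V : GradedSpace.{u, v} k} {W : GradedSpace.{u, w} k}
    (f : GradedHom V W) (hf : Function.Injective f) (d : ℤ) (x : V) (h : f x ∈ W.deg d) :
    x ∈ V.deg d := by
  have : V.proj d x = x := hf (by rw [f.map_proj, W.proj_self h])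
  exact this ▸ V.proj_mem d x

end Maps

/-! ### The universal property of the free `A∞`-algebra -/

section FreeLift

variable {k : Type u} [Field k] {V : GradedSpace.{u, v} k}

/-- The value of a formal expression under an assignment of its leaves. -/
noncomputable def Term.eval (E : OpAlgebra.{u, w} k) (f : GradedHom V E.toGradedSpace) :
    Term V → E.carrier
  | .leaf _ x => f (x : V)
  | .node n t => E.op (n + 1) fun i => (t i).eval E f

theorem Term.eval_mem (E : OpAlgebra.{u, w} k) (f : GradedHom V E.toGradedSpace) (t : Term V) :
    t.eval E f ∈ E.deg t.degree := by
  induction t with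
  | leaf d x => exact f.map_deg d _ x.2
  | node n t ih => exact E.op_deg (n + 1) (fun i => (t i).degree) _ ih

/-- The linear extension of `Term.eval`. -/
noncomputable def termLift (E : OpAlgebra.{u, w} k) (f : GradedHom V E.toGradedSpace) :
    GradedHom (termAlgebra V).toGradedSpace E.toGradedSpace where
  toLinearMap := Finsupp.linearCombination k (Term.eval E f)
  map_deg d x hx := by
    refine Submodule.sum_mem _ fun t ht => Submodule.smul_mem _ _ ?_
    have h : t.degree = d := hx ht
    exact h ▸ t.eval_mem E f

theorem termLift_single (E : OpAlgebra.{u, w} k) (f : GradedHom V E.toGradedSpace) (t : Term V) :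
    termLift E f (Finsupp.single t 1 : Term V →₀ k) = t.eval E f := by
  change Finsupp.linearCombination k (Term.eval E f) _ = _
  simp

theorem termLift_op (E : OpAlgebra.{u, w} k) (f : GradedHom V E.toGradedSpace) (n : ℕ)
    (x : Fin n → (termAlgebra V).carrier) :
    termLift E f ((termAlgebra V).op n x) = E.op n fun i => termLift E f (x i) := by
  rcases n with _ | n
  · rw [OpAlgebra.op_zero, OpAlgebra.op_zero]
    exact map_zero _
  · have h : (Finsupp.linearCombination k (Term.eval E f)).compMultilinearMap (termOp V (n + 1))
        = (E.op (n + 1)).compLinearMap fun _ => Finsupp.linearCombination k (Term.eval E f) := by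
      -- Both sides are multilinear, so they are compared on the basis of formal expressions, where
      -- the claim is the recursive clause of `Term.eval`.
      refine Module.Basis.ext_multilinear (fun _ => Finsupp.basisSingleOne) fun t => ?_
      simp only [Finsupp.coe_basisSingleOne, LinearMap.compMultilinearMap_apply,
        MultilinearMap.compLinearMap_apply, termOp_single, Finsupp.linearCombination_single,
        one_smul, Term.eval]
    exact congrArg (fun m => m x) h

/-- The `A∞`-morphism from the free `A∞`-algebra which extends a linear map of degree zero. -/
noncomputable def freeLift (E : AInfAlgebra.{u, w} k) (f : GradedHom V E.toGradedSpace) :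
    AInfAlgebra.Hom (freeAInf V) E where
  toGradedHom := OpAlgebra.quotientLift (termLift E.toOpAlgebra f)
    ((termAlgebra V).idealSpan_isIdeal (FreeRel V)) (by
      refine OpAlgebra.idealSpan_le (OpAlgebra.ker_isIdeal _ (termLift_op E.toOpAlgebra f)) ?_
      -- The leaf relations hold because `f` is linear. The third kind holds because `E` is an
      -- `A∞`-algebra and evaluation preserves degrees.
      rintro _ (⟨d, x, y⟩ | ⟨d, a, x⟩ | ⟨n, d, x, hx⟩)
      · change termLift E.toOpAlgebra f _ = 0
        rw [map_sub, map_add]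
        simp only [termLeaf, termLift_single, Term.eval]
        simp
      · change termLift E.toOpAlgebra f _ = 0
        rw [map_sub, map_smul]
        simp only [termLeaf, termLift_single, Term.eval]
        simp
      · change termLift E.toOpAlgebra f _ = 0
        rw [OpAlgebra.map_ainfRel _ (termLift_op E.toOpAlgebra f)]
        exact E.ainf n d _ fun i => (termLift E.toOpAlgebra f).map_deg _ _ (hx i))
  map_op := OpAlgebra.quotientLift_op _ (termLift_op E.toOpAlgebra f) _ _

theorem freeι_of_mem {d : ℤ} (x : V.deg d) : freeι V x = freeMk V (termLeaf V d x) := by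
  change DirectSum.toModule k ℤ _ (freeLeaf V) (V.decompose x) = _
  rw [V.decompose_of_mem x.2, DirectSum.toModule_lof]
  rfl

theorem freeLift_ι (E : AInfAlgebra.{u, w} k) (f : GradedHom V E.toGradedSpace) (x : V) :
    freeLift E f (freeι V x) = f x := by
  refine V.mem_of_deg_le (N := LinearMap.eqLocus
    ((freeLift E f).toLinearMap ∘ₗ (freeι V).toLinearMap) f.toLinearMap) (fun d y hy => ?_) x
  change freeLift E f (freeι V ((⟨y, hy⟩ : V.deg d) : V)) = f y
  rw [freeι_of_mem]
  exact termLift_single E.toOpAlgebra f _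

/-- A subspace of the free `A∞`-algebra which contains the generators and is closed under the
operations is everything. -/
theorem freeAInf_induction (N : Submodule k (freeAInf V).carrier) (hι : ∀ x, freeι V x ∈ N)
    (hop : ∀ n x, (∀ i, x i ∈ N) → (freeAInf V).op n x ∈ N) (x : (freeAInf V).carrier) :
    x ∈ N := by
  obtain ⟨y, rfl⟩ := OpAlgebra.quotientMk_surjective
    ((termAlgebra V).idealSpan_isIdeal (FreeRel V)) x
  change freeMk V y ∈ N
  have hs : ∀ t : Term V, freeMk V (Finsupp.single t 1 : Term V →₀ k) ∈ N := by
    intro t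
    induction t with
    | leaf d x => exact freeι_of_mem x ▸ hι x
    | node n t ih =>
      rw [← termOp_single]
      have := hop (n + 1) _ ih
      exact (OpAlgebra.quotient_op ((termAlgebra V).idealSpan_isIdeal (FreeRel V)) (n + 1)
        (fun i => (Finsupp.single (t i) 1 : Term V →₀ k))) ▸ this
  change y ∈ N.comap (freeMk V).toLinearMap
  have h : ∀ z : Term V →₀ k, z ∈ (N.comap (freeMk V).toLinearMap : Submodule k (Term V →₀ k)) := by
    intro z
    induction z using Finsupp.induction_linear with
    | zero => exact Submodule.zero_mem _
    | add x y hx hy => exact Submodule.add_mem _ hx hy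
    | single t a =>
      have e : Finsupp.single t a = a • Finsupp.single t (1 : k) := by simp
      rw [e]
      exact Submodule.smul_mem _ _ (hs t)
  exact h y

end FreeLift

/-! ### Koszul signs -/

section Koszul

/-- A product over pairs `i < j` of a symmetric function is invariant under permutations. -/
theorem prod_lt_comp_perm {n : ℕ} (F : Fin n → Fin n → ℤ) (hF : ∀ i j, F i j = F j i)
    (σ : Equiv.Perm (Fin n)) :
    (∏ i, ∏ j, if i < j then F (σ i) (σ j) else 1) = ∏ i, ∏ j, if i < j then F i j else 1 := by
  have h1 : (∏ i, ∏ j, if i < j then F i j else 1)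
      = ∏ i, ∏ j, if σ i < σ j then F (σ i) (σ j) else 1 := by
    rw [← Equiv.prod_comp σ]
    refine Finset.prod_congr rfl fun i _ => ?_
    rw [← Equiv.prod_comp σ]
  have h2 : (∏ i, ∏ j, if σ i < σ j then F (σ i) (σ j) else 1)
      = (∏ i, ∏ j, if i < j ∧ σ i < σ j then F (σ i) (σ j) else 1) *
        ∏ i, ∏ j, if j < i ∧ σ i < σ j then F (σ i) (σ j) else 1 := by
    simp only [← Finset.prod_mul_distrib]
    refine Finset.prod_congr rfl fun i _ => Finset.prod_congr rfl fun j _ => ?_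
    rcases lt_trichotomy i j with h | rfl | h
    · simp [h, h.not_gt]
    · simp
    · simp [h, h.not_gt]
  have h3 : (∏ i, ∏ j, if i < j then F (σ i) (σ j) else 1)
      = (∏ i, ∏ j, if i < j ∧ σ i < σ j then F (σ i) (σ j) else 1) *
        ∏ i, ∏ j, if i < j ∧ σ j < σ i then F (σ i) (σ j) else 1 := by
    simp only [← Finset.prod_mul_distrib]
    refine Finset.prod_congr rfl fun i _ => Finset.prod_congr rfl fun j _ => ?_
    by_cases hij : i < j
    · rcases lt_trichotomy (σ i) (σ j) with h | h | h
      · simp [hij, h, h.not_gt]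
      · exact absurd (σ.injective h) hij.ne
      · simp [hij, h, h.not_gt]
    · simp [hij]
  -- The first factors agree. The second ones both run over the pairs reversed by `σ`, with the
  -- roles of `i` and `j` exchanged; swapping the products and the symmetry of `F` match them.
  rw [h1, h2, h3, Finset.prod_comm (f := fun i j => if j < i ∧ σ i < σ j then _ else _)]
  congr 1
  refine Finset.prod_congr rfl fun i _ => Finset.prod_congr rfl fun j _ => ?_
  rw [hF]

/-- A pair changes its order under the composite exactly when one, but not both, of the two
permutations reverses it; a pair reversed twice contributes the square of a sign. -/
theorem koszul_mul {n : ℕ} (d : Fin n → ℤ) (σ τ : Equiv.Perm (Fin n)) :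
    koszul d (σ * τ) = koszul d σ * koszul (fun i => d (σ i)) τ := by
  -- For `i < j` this is the factor of `koszul d σ`. Phrasing the condition as an equivalence makes
  -- it symmetric in `i` and `j`, so that `prod_lt_comp_perm` can move the product to the pairs `τ
  -- i, τ j`.
  let F : Fin n → Fin n → ℤ := fun i j =>
    if (i < j ↔ σ j < σ i) then ((d (σ i) * d (σ j)).negOnePow : ℤ) else 1
  have hF : ∀ i j, F i j = F j i := by
    intro i j
    rcases eq_or_ne i j with rfl | hij
    · rfl
    · have hσ : σ i ≠ σ j := fun h => hij (σ.injective h)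
      have : (i < j ↔ σ j < σ i) ↔ (j < i ↔ σ i < σ j) := by
        rcases hij.lt_or_gt with h | h <;> rcases hσ.lt_or_gt with h' | h' <;>
          simp [h, h', h.not_gt, h'.not_gt]
      simp only [F, this, mul_comm (d (σ i))]
  have h1 : koszul d σ = ∏ i, ∏ j, if i < j then F i j else 1 := by
    unfold koszul
    refine Finset.prod_congr rfl fun i _ => Finset.prod_congr rfl fun j _ => ?_
    by_cases hij : i < j <;> simp [F, hij]
  rw [h1, ← prod_lt_comp_perm F hF τ]
  simp only [koszul, ← Finset.prod_mul_distrib]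
  refine Finset.prod_congr rfl fun i _ => Finset.prod_congr rfl fun j _ => ?_
  by_cases hij : i < j
  · have hne : τ i ≠ τ j := fun h => hij.ne (τ.injective h)
    have hs : ((d (σ (τ i)) * d (σ (τ j))).negOnePow : ℤ)
        * ((d (σ (τ i)) * d (σ (τ j))).negOnePow : ℤ) = 1 := by
      rw [← Units.val_mul, Int.units_mul_self, Units.val_one]
    by_cases h2 : σ (τ j) < σ (τ i) <;> rcases hne.lt_or_gt with h | h <;>
      simp [F, hij, h2, h, h.not_gt, hs]
  · simp [hij]

theorem koszul_one {n : ℕ} (d : Fin n → ℤ) : koszul d 1 = 1 := by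
  unfold koszul
  refine Finset.prod_eq_one fun i _ => Finset.prod_eq_one fun j _ => if_neg ?_
  exact fun h => h.1.not_gt h.2

theorem koszul_cast {n n' : ℕ} (h : n = n') (d : Fin n' → ℤ) (σ : Equiv.Perm (Fin n)) :
    koszul d ((finCongr h).permCongr σ) = koszul (fun i => d (Fin.cast h i)) σ := by
  subst h
  congr 1

/-- The permutation `α ⊕ β` of a word of length `a + b`. -/
def blockPerm {a b : ℕ} (α : Equiv.Perm (Fin a)) (β : Equiv.Perm (Fin b)) :
    Equiv.Perm (Fin (a + b)) :=
  finSumFinEquiv.permCongr (Equiv.sumCongr α β)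

variable {a b : ℕ} (α α' : Equiv.Perm (Fin a)) (β β' : Equiv.Perm (Fin b))

@[simp]
theorem blockPerm_castAdd (i : Fin a) :
    blockPerm α β (Fin.castAdd b i) = Fin.castAdd b (α i) := by
  simp [blockPerm, Equiv.permCongr_apply]

@[simp]
theorem blockPerm_natAdd (i : Fin b) :
    blockPerm α β (Fin.natAdd a i) = Fin.natAdd a (β i) := by
  simp [blockPerm, Equiv.permCongr_apply]

theorem blockPerm_mul : blockPerm α β * blockPerm α' β' = blockPerm (α * α') (β * β') := by
  ext i
  refine Fin.addCases (fun i => ?_) (fun i => ?_) i <;> simp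

@[simp]
theorem blockPerm_one : blockPerm (1 : Equiv.Perm (Fin a)) (1 : Equiv.Perm (Fin b)) = 1 := by
  ext i
  refine Fin.addCases (fun i => ?_) (fun i => ?_) i <;> simp

theorem blockPerm_inv : (blockPerm α β)⁻¹ = blockPerm α⁻¹ β⁻¹ := by
  rw [inv_eq_iff_mul_eq_one, blockPerm_mul, mul_inv_cancel, mul_inv_cancel, blockPerm_one]

theorem append_blockPerm {γ : Type*} (x : Fin a → γ) (y : Fin b → γ) (j : Fin (a + b)) :
    Fin.append x y (blockPerm α β j)
      = Fin.append (fun i => x (α i)) (fun i => y (β i)) j := by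
  refine Fin.addCases (fun i => ?_) (fun i => ?_) j <;> simp

/-- No pair with one letter in each block is reversed, so only the pairs inside the blocks
contribute. -/
theorem koszul_blockPerm (d : Fin a → ℤ) (e : Fin b → ℤ) :
    koszul (Fin.append d e) (blockPerm α β) = koszul d α * koszul e β := by
  unfold koszul
  rw [Fin.prod_univ_add]
  have h1 : ∀ (i : Fin a) (j : Fin b), ¬ Fin.natAdd a j < Fin.castAdd b i := by
    intro i j
    rw [Fin.lt_def, Fin.val_natAdd, Fin.val_castAdd]
    omega
  have h2 : ∀ i j : Fin b, Fin.natAdd a i < Fin.natAdd a j ↔ i < j := by simp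
  have h3 : ∀ i j : Fin a, Fin.castAdd b i < Fin.castAdd b j ↔ i < j := fun i j => Iff.rfl
  simp only [Fin.prod_univ_add, blockPerm_castAdd, blockPerm_natAdd, h1, h2, h3, Fin.append_left,
    Fin.append_right, and_false, false_and, if_false, Finset.prod_const_one, mul_one, one_mul]

end Koszul

/-! ### Shuffles -/

section Shuffles

/-- Sorted rearrangements coincide, and injectivity of `f` recovers the permutation. This gives the
uniqueness in the factorization of permutations through shuffles. -/
theorem sort_eq_of_monotone {n : ℕ} {β : Type*} [LinearOrder β] {f : Fin n → β}
    (hf : Function.Injective f) {σ : Equiv.Perm (Fin n)} (h : Monotone (f ∘ σ)) :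
    Tuple.sort f = σ := by
  have := Tuple.unique_monotone (Tuple.monotone_sort f) h
  exact Equiv.ext fun i => hf (congrFun this i)

theorem mem_shuffles {p q : ℕ} {τ : Equiv.Perm (Fin (p + q))} :
    τ ∈ shuffles p q ↔ StrictMono (fun i : Fin p => τ⁻¹ (Fin.castAdd q i)) ∧
      StrictMono (fun i : Fin q => τ⁻¹ (Fin.natAdd p i)) := by
  simp [shuffles, StrictMono]

variable {G : Type*} [AddCommMonoid G]

/-- Every permutation factors uniquely as `(α ⊕ β) τ` with a shuffle `τ`. -/
theorem sum_perm_eq_sum_shuffles (p q : ℕ) (f : Equiv.Perm (Fin (p + q)) → G) :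
    ∑ θ, f θ = ∑ α : Equiv.Perm (Fin p), ∑ β : Equiv.Perm (Fin q), ∑ τ ∈ shuffles p q,
      f (blockPerm α β * τ) := by
  have hc : ∀ (θ : Equiv.Perm (Fin (p + q))),
      Function.Injective fun i : Fin p => θ⁻¹ (Fin.castAdd q i) := fun θ =>
    θ⁻¹.injective.comp (Fin.castAdd_injective p q)
  have hn : ∀ (θ : Equiv.Perm (Fin (p + q))),
      Function.Injective fun i : Fin q => θ⁻¹ (Fin.natAdd p i) := fun θ =>
    θ⁻¹.injective.comp (Fin.natAdd_injective q p)
  simp only [← Finset.sum_product']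
  -- `θ⁻¹` gives the position of a label in the word `θ`. `A θ` and `B θ` sort the positions of the
  -- two blocks of labels; once they are divided out, both blocks occur in increasing order, which
  -- is a shuffle.
  let A : Equiv.Perm (Fin (p + q)) → Equiv.Perm (Fin p) := fun θ =>
    Tuple.sort fun i => θ⁻¹ (Fin.castAdd q i)
  let B : Equiv.Perm (Fin (p + q)) → Equiv.Perm (Fin q) := fun θ =>
    Tuple.sort fun i => θ⁻¹ (Fin.natAdd p i)
  refine Finset.sum_nbij' (fun θ => (A θ, B θ, (blockPerm (A θ) (B θ))⁻¹ * θ))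
    (fun x => blockPerm x.1 x.2.1 * x.2.2) ?_ ?_ ?_ ?_ ?_
  · intro θ _
    simp only [Finset.mem_product, Finset.mem_univ, true_and]
    rw [mem_shuffles]
    constructor
    · have h := (Tuple.monotone_sort fun i => θ⁻¹ (Fin.castAdd q i)).strictMono_of_injective
        ((hc θ).comp (A θ).injective)
      intro i j hij
      simpa [A] using h hij
    · have h := (Tuple.monotone_sort fun i => θ⁻¹ (Fin.natAdd p i)).strictMono_of_injective
        ((hn θ).comp (B θ).injective)
      intro i j hij
      simpa [B] using h hij
  · exact fun _ _ => Finset.mem_univ _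
  · exact fun θ _ => mul_inv_cancel_left _ _
  · rintro ⟨α, β, τ⟩ hτ
    simp only [Finset.mem_product, Finset.mem_univ, true_and, mem_shuffles] at hτ
    have hA : A (blockPerm α β * τ) = α := by
      refine sort_eq_of_monotone (hc _) fun i j hij => ?_
      simpa [blockPerm_inv] using hτ.1.monotone hij
    have hB : B (blockPerm α β * τ) = β := by
      refine sort_eq_of_monotone (hn _) fun i j hij => ?_
      simpa [blockPerm_inv] using hτ.2.monotone hij
    simp only [hA, hB, inv_mul_cancel_left]
  · intro θ _
    simp

/-- The permutations whose inverse is increasing on the last `q` labels. -/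
def openPerms (p q : ℕ) : Finset (Equiv.Perm (Fin (p + q))) :=
  Finset.univ.filter fun θ => StrictMono fun i : Fin q => θ⁻¹ (Fin.natAdd p i)

theorem mem_openPerms {p q : ℕ} {θ : Equiv.Perm (Fin (p + q))} :
    θ ∈ openPerms p q ↔ StrictMono fun i : Fin q => θ⁻¹ (Fin.natAdd p i) := by
  simp [openPerms]

theorem strictMono_comp_iff {α β γ : Type*} [LinearOrder α] [LinearOrder β] [Preorder γ]
    {f : β → γ} (hf : StrictMono f) {g : α → β} :
    StrictMono (fun i => f (g i)) ↔ StrictMono g :=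
  ⟨fun h _ _ hij => hf.lt_iff_lt.1 (h hij), hf.comp⟩

/-- The shuffle already keeps the second block increasing, so the condition says that `β⁻¹` is
increasing, and the only increasing permutation is the identity. -/
theorem blockPerm_mul_mem_openPerms {p q : ℕ} {α : Equiv.Perm (Fin p)} {β : Equiv.Perm (Fin q)}
    {τ : Equiv.Perm (Fin (p + q))} (hτ : τ ∈ shuffles p q) :
    blockPerm α β * τ ∈ openPerms p q ↔ β = 1 := by
  rw [mem_openPerms]
  have h : (fun i : Fin q => (blockPerm α β * τ)⁻¹ (Fin.natAdd p i))
      = fun i => (fun i => τ⁻¹ (Fin.natAdd p i)) (β⁻¹ i) := by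
    ext i
    simp [blockPerm_inv]
  rw [h, strictMono_comp_iff (mem_shuffles.1 hτ).2]
  constructor
  · intro hβ
    have h1 : Tuple.sort (id : Fin q → Fin q) = β⁻¹ :=
      sort_eq_of_monotone Function.injective_id hβ.monotone
    have h2 : Tuple.sort (id : Fin q → Fin q) = 1 :=
      sort_eq_of_monotone Function.injective_id monotone_id
    rw [← inv_inj, ← h1, h2, inv_one]
  · rintro rfl
    exact strictMono_id

theorem sum_openPerms_eq_ite (p q : ℕ) (f : Equiv.Perm (Fin (p + q)) → G) :
    ∑ θ ∈ openPerms p q, f θ = ∑ θ, if θ ∈ openPerms p q then f θ else 0 := by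
  rw [← Finset.sum_filter]
  simp

/-- A symmetrization followed by shuffles thereby becomes one sum over a single set of permutations,
which can then be decomposed in other ways. -/
theorem sum_openPerms (p q : ℕ) (f : Equiv.Perm (Fin (p + q)) → G) :
    ∑ θ ∈ openPerms p q, f θ = ∑ α : Equiv.Perm (Fin p), ∑ τ ∈ shuffles p q,
      f (blockPerm α 1 * τ) := by
  rw [sum_openPerms_eq_ite, sum_perm_eq_sum_shuffles]
  refine Finset.sum_congr rfl fun α _ => ?_
  rw [Finset.sum_comm]
  refine Finset.sum_congr rfl fun τ hτ => ?_
  simp [blockPerm_mul_mem_openPerms hτ]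

/-- In the factorization for the blocks `m | s + q`, the shuffle does not alter the relative order
of the last `s + q` labels, so the condition on the last `q` labels falls on `β` alone. -/
theorem sum_openPerms_assoc (m s q : ℕ) (f : Equiv.Perm (Fin (m + s + q)) → G) :
    ∑ θ ∈ openPerms (m + s) q, f θ = ∑ α : Equiv.Perm (Fin m), ∑ β ∈ openPerms s q,
      ∑ τ ∈ shuffles m (s + q),
        f ((finCongr (Nat.add_assoc m s q).symm).permCongr (blockPerm α β * τ)) := by
  rw [sum_openPerms_eq_ite, ← Equiv.sum_comp (finCongr (Nat.add_assoc m s q).symm).permCongr,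
    sum_perm_eq_sum_shuffles]
  refine Finset.sum_congr rfl fun α _ => ?_
  rw [sum_openPerms_eq_ite]
  refine Finset.sum_congr rfl fun β _ => ?_
  have key : ∀ τ ∈ shuffles m (s + q),
      ((finCongr (Nat.add_assoc m s q).symm).permCongr (blockPerm α β * τ) ∈ openPerms (m + s) q
        ↔ β ∈ openPerms s q) := by
    intro τ hτ
    rw [mem_openPerms, mem_openPerms, ← strictMono_comp_iff (mem_shuffles.1 hτ).2]
    have e : ∀ i : Fin q, ((finCongr (Nat.add_assoc m s q).symm).permCongr
        (blockPerm α β * τ))⁻¹ (Fin.natAdd (m + s) i)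
          = Fin.cast (Nat.add_assoc m s q).symm
            (τ⁻¹ (Fin.natAdd m (β⁻¹ (Fin.natAdd s i)))) := by
      intro i
      rw [Equiv.Perm.inv_eq_iff_eq]
      have e1 : Fin.natAdd (m + s) i = Fin.cast (Nat.add_assoc m s q).symm
          (Fin.natAdd m (Fin.natAdd s i)) := by
        ext
        simp [Nat.add_assoc]
      simp [Equiv.permCongr_apply, e1]
    simp only [e]
    rfl
  split_ifs with hβ
  · exact Finset.sum_congr rfl fun τ hτ => if_pos ((key τ hτ).2 hβ)
  · exact Finset.sum_eq_zero fun τ hτ => if_neg fun h => hβ ((key τ hτ).1 h)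

theorem openPerms_mul_iff {p q : ℕ} (σ : Equiv.Perm (Fin p)) (θ : Equiv.Perm (Fin (p + q))) :
    blockPerm σ 1 * θ ∈ openPerms p q ↔ θ ∈ openPerms p q := by
  simp [mem_openPerms, blockPerm_inv]

theorem sum_openPerms_mul_left (p q : ℕ) (σ : Equiv.Perm (Fin p))
    (f : Equiv.Perm (Fin (p + q)) → G) :
    ∑ θ ∈ openPerms p q, f (blockPerm σ 1 * θ) = ∑ θ ∈ openPerms p q, f θ := by
  refine Finset.sum_nbij' (fun θ => blockPerm σ 1 * θ) (fun θ => (blockPerm σ 1)⁻¹ * θ)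
    ?_ ?_ ?_ ?_ ?_
  · exact fun θ h => (openPerms_mul_iff σ θ).2 h
  · intro θ h
    rw [blockPerm_inv, inv_one]
    exact (openPerms_mul_iff _ θ).2 h
  · exact fun θ _ => inv_mul_cancel_left _ _
  · exact fun θ _ => mul_inv_cancel_left _ _
  · exact fun _ _ => rfl

end Shuffles

/-! ### Symmetrized shuffles of sums -/

section SymmetrizedShuffles

theorem exists_perm_map_eq {α : Type*} [Finite α] [DecidableEq α] {S T : Finset α}
    (h : S.card = T.card) : ∃ g : Equiv.Perm α, S.map g.toEmbedding = T := by
  let e := Finset.equivOfCardEq h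
  refine ⟨e.extendSubtype, Finset.eq_of_subset_of_card_le (fun x hx => ?_) (by simp [h])⟩
  obtain ⟨y, hy, rfl⟩ := Finset.mem_map.1 hx
  exact e.extendSubtype_mem y hy

/-- Summation over the translates of a subset by all permutations. -/
theorem sum_perm_map {p m : ℕ} {S : Finset (Fin p)} (hS : S.card = m) {G : Type*}
    [AddCommMonoid G] (h : Finset (Fin p) → G) :
    ∑ σ : Equiv.Perm (Fin p), h (S.map σ.toEmbedding)
      = (m.factorial * (p - m).factorial) • ∑ T ∈ Finset.powersetCard m Finset.univ, h T := by
  have hmaps : ∀ σ ∈ (Finset.univ : Finset (Equiv.Perm (Fin p))),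
      S.map σ.toEmbedding ∈ Finset.powersetCard m (Finset.univ : Finset (Fin p)) := by
    intro σ _
    simp [Finset.mem_powersetCard, hS]
  let F : Finset (Fin p) → Finset (Equiv.Perm (Fin p)) := fun T =>
    Finset.univ.filter fun σ => S.map σ.toEmbedding = T
  -- Permutations act transitively on subsets of size `m`, so translation by `g` identifies the
  -- fibres. Dividing `p!` by the number of such subsets then gives their common size.
  have hcard : ∀ T ∈ Finset.powersetCard m (Finset.univ : Finset (Fin p)),
      (F T).card = (F S).card := by
    intro T hT
    obtain ⟨g, rfl⟩ := exists_perm_map_eq (hS.trans (Finset.mem_powersetCard.1 hT).2.symm)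
    have hmul : ∀ a b : Equiv.Perm (Fin p),
        S.map (a * b).toEmbedding = (S.map b.toEmbedding).map a.toEmbedding := by
      intro a b
      rw [Finset.map_map]
      rfl
    refine Finset.card_nbij' (fun σ => g⁻¹ * σ) (fun σ => g * σ) ?_ ?_ ?_ ?_
    · intro σ hσ
      simp only [F, Finset.coe_filter, Finset.mem_univ, true_and, Set.mem_ofPred_eq] at hσ ⊢
      rw [hmul, hσ, ← hmul, inv_mul_cancel]
      exact Finset.map_refl
    · intro σ hσ
      simp only [F, Finset.coe_filter, Finset.mem_univ, true_and, Set.mem_ofPred_eq] at hσ ⊢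
      rw [hmul, hσ]
    · exact fun σ _ => mul_inv_cancel_left _ _
    · exact fun σ _ => inv_mul_cancel_left _ _
  have hm : m ≤ p := by
    simpa [hS] using Finset.card_le_univ S
  have hF : (F S).card = m.factorial * (p - m).factorial := by
    have h1 := Finset.card_eq_sum_card_fiberwise hmaps
    rw [Finset.sum_congr rfl hcard, Finset.sum_const, Finset.card_powersetCard, Finset.card_univ,
      Finset.card_univ, Fintype.card_perm, Fintype.card_fin, smul_eq_mul,
      ← Nat.choose_mul_factorial_mul_factorial hm, mul_assoc] at h1
    exact (Nat.eq_of_mul_eq_mul_left (Nat.choose_pos hm) h1).symm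
  rw [← Finset.sum_fiberwise_of_maps_to hmaps, Finset.smul_sum]
  refine Finset.sum_congr rfl fun T hT => ?_
  rw [← hF, ← hcard T hT, ← Finset.sum_const]
  refine Finset.sum_congr rfl fun σ hσ => ?_
  rw [(Finset.mem_filter.1 hσ).2]

variable {k : Type u} [Field k] {E : Type v} [AddCommGroup E] [Module k E] {W : Type w}
  [AddCommGroup W] [Module k W]

/-- The sum over all words in which `x₁, …, x_p` occur in any order and `o₁, …, o_q` occur in
increasing order. -/
noncomputable def openSum {p q : ℕ} (M : MultilinearMap k (fun _ : Fin (p + q) => E) W)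
    (d : Fin p → ℤ) (x : Fin p → E) (e : Fin q → ℤ) (o : Fin q → E) : W :=
  ∑ θ ∈ openPerms p q, koszul (Fin.append d e) θ • M fun j => Fin.append x o (θ j)

variable {p q : ℕ} (M : MultilinearMap k (fun _ : Fin (p + q) => E) W)
    (d : Fin p → ℤ) (x : Fin p → E) (e : Fin q → ℤ) (o : Fin q → E)

/-- Relabelling the first `p` letters preserves `openPerms`, and the sign splits off by the cocycle
identity. -/
theorem openSum_comp_perm (σ : Equiv.Perm (Fin p)) :
    openSum M d x e o
      = koszul d σ • openSum M (fun i => d (σ i)) (fun i => x (σ i)) e o := by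
  rw [openSum, ← sum_openPerms_mul_left p q σ, openSum, Finset.smul_sum]
  refine Finset.sum_congr rfl fun θ _ => ?_
  rw [koszul_mul, koszul_blockPerm, koszul_one, mul_one, smul_smul]
  simp only [Equiv.Perm.mul_apply, append_blockPerm, Equiv.Perm.one_apply]

theorem openSum_eq_sum_shuffles :
    openSum M d x e o = ∑ σ : Equiv.Perm (Fin p), koszul d σ • ∑ τ ∈ shuffles p q,
      koszul (Fin.append (fun i => d (σ i)) e) τ •
        M fun j => Fin.append (fun i => x (σ i)) o (τ j) := by
  rw [openSum, sum_openPerms]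
  refine Finset.sum_congr rfl fun σ _ => ?_
  rw [Finset.smul_sum]
  refine Finset.sum_congr rfl fun τ _ => ?_
  rw [koszul_mul, koszul_blockPerm, koszul_one, mul_one, smul_smul]
  simp only [Equiv.Perm.mul_apply, append_blockPerm, Equiv.Perm.one_apply]

theorem openSum_add (y : Fin p → E) :
    openSum M d (fun i => x i + y i) e o
      = ∑ T : Finset (Fin p), openSum M d (T.piecewise x y) e o := by
  simp only [openSum]
  rw [Finset.sum_comm]
  refine Finset.sum_congr rfl fun θ _ => ?_
  rw [← Finset.smul_sum]
  congr 1
  -- For a fixed order `θ`, currying separates the first `p` letters from `o`, so that the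
  -- multilinear expansion over subsets applies to them alone.
  let N := ((M.domDomCongr θ).domDomCongr finSumFinEquiv.symm).currySum
  have hN : ∀ z : Fin p → E, N z o = M fun j => Fin.append z o (θ j) := by
    intro z
    have h : (fun i => Sum.rec z o (finSumFinEquiv.symm i)) = (Fin.append z o : Fin (p + q) → E) := by
      ext i
      refine Fin.addCases (fun i => ?_) (fun i => ?_) i <;> simp
    rw [← h]
    rfl
  simp only [← hN]
  rw [← sum_apply]
  exact congrArg (fun m => m o) (N.map_add_univ x y)

/-- The part of a symmetrized shuffle product with first letters `x₁, …, x_m`, and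
`y₁, …, y_s | o₁, …, o_q` shuffled. -/
noncomputable def nestedShuffle (M : (n : ℕ) → MultilinearMap k (fun _ : Fin n => E) W)
    {m s q : ℕ} (d : Fin m → ℤ) (x : Fin m → E) (d' : Fin s → ℤ) (y : Fin s → E)
    (e : Fin q → ℤ) (o : Fin q → E) : W :=
  ∑ τ ∈ shuffles s q, koszul (Fin.append d' e) τ • ∑ ρ : Equiv.Perm (Fin m), koszul d ρ •
    ∑ τ' ∈ shuffles m (s + q),
      koszul (Fin.append (fun i => d (ρ i)) fun j => Fin.append d' e (τ j)) τ' •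
        M (m + (s + q)) fun j =>
          Fin.append (fun i => x (ρ i)) (fun j => Fin.append y o (τ j)) (τ' j)

theorem apply_comp_cast (M : (n : ℕ) → MultilinearMap k (fun _ : Fin n => E) W) {n n' : ℕ}
    (h : n = n') (x : Fin n' → E) : M n (fun i => x (Fin.cast h i)) = M n' x := by
  subst h
  rfl

theorem append_append_cast {γ : Type*} {m s q : ℕ} (x : Fin m → γ) (y : Fin s → γ)
    (o : Fin q → γ) (j : Fin (m + (s + q))) :
    Fin.append (Fin.append x y) o (Fin.cast (Nat.add_assoc m s q).symm j)
      = Fin.append x (Fin.append y o) j := by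
  rw [Fin.append_assoc]
  simp

/-- A word is built by ordering `y` by `γ`, shuffling it into `o` by `τ`, ordering `x` by `ρ` and
shuffling it in by `τ'`. The sum over `γ` stays outside, to be absorbed later into a sum over all
permutations. -/
theorem openSum_append (M : (n : ℕ) → MultilinearMap k (fun _ : Fin n => E) W)
    {m s q : ℕ} (d : Fin m → ℤ) (x : Fin m → E) (d' : Fin s → ℤ) (y : Fin s → E)
    (e : Fin q → ℤ) (o : Fin q → E) :
    openSum (M (m + s + q)) (Fin.append d d') (Fin.append x y) e o
      = ∑ γ : Equiv.Perm (Fin s), koszul d' γ •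
        nestedShuffle M d x (fun i => d' (γ i)) (fun i => y (γ i)) e o := by
  rw [openSum, sum_openPerms_assoc]
  simp only [nestedShuffle, Finset.smul_sum]
  simp only [sum_openPerms]
  rw [Finset.sum_comm]
  refine Finset.sum_congr rfl fun γ _ => ?_
  rw [Finset.sum_comm]
  refine Finset.sum_congr rfl fun τ _ => Finset.sum_congr rfl fun ρ _ =>
    Finset.sum_congr rfl fun τ' _ => ?_
  rw [koszul_cast, ← apply_comp_cast M (Nat.add_assoc m s q).symm]
  simp only [append_append_cast, Equiv.permCongr_apply, finCongr_symm, finCongr_apply,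
    Fin.cast_cast, Fin.cast_eq_self, Equiv.Perm.mul_apply, append_blockPerm, koszul_mul,
    koszul_blockPerm, koszul_one, mul_one, smul_smul, Equiv.Perm.one_apply]
  congr 1
  ring

theorem append_castAdd_natAdd {γ : Type*} {m s : ℕ} (x : Fin (m + s) → γ) :
    Fin.append (fun i => x (Fin.castAdd s i)) (fun i => x (Fin.natAdd m i)) = x := by
  ext i
  refine Fin.addCases (fun i => ?_) (fun i => ?_) i <;> simp

/-- Summing over the translates of the first `m` positions meets each subset `m! s!` times. Moving
the letters of a translate to the front leaves a sum over orders `γ` of the last `s` letters; the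
substitution `σ ↦ σ (1 ⊕ γ)` turns it into `s!` equal sums. In characteristic zero `s!` cancels and
`m!` is inverted. -/
theorem sum_openSum_powersetCard [CharZero k]
    (M : (n : ℕ) → MultilinearMap k (fun _ : Fin n => E) W)
    {m s q : ℕ} (d : Fin (m + s) → ℤ) (x y : Fin (m + s) → E) (e : Fin q → ℤ) (o : Fin q → E) :
    ∑ T ∈ Finset.powersetCard m Finset.univ,
        openSum (M (m + s + q)) d (T.piecewise x y) e o
      = (m.factorial : k)⁻¹ • ∑ σ : Equiv.Perm (Fin (m + s)), koszul d σ •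
        nestedShuffle M (fun i => d (σ (Fin.castAdd s i))) (fun i => x (σ (Fin.castAdd s i)))
          (fun i => d (σ (Fin.natAdd m i))) (fun i => y (σ (Fin.natAdd m i))) e o := by
  let S : Finset (Fin (m + s)) := Finset.univ.map (Fin.castAddEmb s)
  have hS : S.card = m := by simp [S]
  have hsum := sum_perm_map hS fun T => openSum (M (m + s + q)) d (T.piecewise x y) e o
  let f : Equiv.Perm (Fin (m + s)) → W := fun σ => koszul d σ •
    nestedShuffle M (fun i => d (σ (Fin.castAdd s i))) (fun i => x (σ (Fin.castAdd s i)))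
      (fun i => d (σ (Fin.natAdd m i))) (fun i => y (σ (Fin.natAdd m i))) e o
  have hσ : ∀ σ : Equiv.Perm (Fin (m + s)),
      openSum (M (m + s + q)) d ((S.map σ.toEmbedding).piecewise x y) e o
        = ∑ γ : Equiv.Perm (Fin s), f (σ * blockPerm 1 γ) := by
    intro σ
    have hw : (fun i => (S.map σ.toEmbedding).piecewise x y (σ i))
        = Fin.append (fun i => x (σ (Fin.castAdd s i))) (fun i => y (σ (Fin.natAdd m i))) := by
      ext i
      refine Fin.addCases (fun i => ?_) (fun i => ?_) i
      · rw [Finset.piecewise_eq_of_mem _ _ _ (by simp [S]), Fin.append_left]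
      · rw [Finset.piecewise_eq_of_notMem _ _ _ (by simp [S, Fin.ext_iff]; omega),
          Fin.append_right]
    rw [openSum_comp_perm _ _ _ _ _ σ, hw, ← append_castAdd_natAdd fun i => d (σ i),
      openSum_append, Finset.smul_sum]
    refine Finset.sum_congr rfl fun γ _ => ?_
    simp only [f]
    rw [koszul_mul, ← append_castAdd_natAdd fun i => d (σ i), koszul_blockPerm, koszul_one, one_mul,
      smul_smul]
    simp
  simp only [hσ] at hsum
  rw [Finset.sum_comm] at hsum
  have hγ : ∀ γ : Equiv.Perm (Fin s), ∑ σ, f (σ * blockPerm 1 γ) = ∑ σ, f σ := fun γ =>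
    Equiv.sum_comp (Equiv.mulRight (blockPerm 1 γ)) f
  rw [Finset.sum_congr rfl fun γ _ => hγ γ, Finset.sum_const, Finset.card_univ, Fintype.card_perm,
    Fintype.card_fin, Nat.add_sub_cancel_left, ← Nat.cast_smul_eq_nsmul k,
    ← Nat.cast_smul_eq_nsmul k, Nat.cast_mul, mul_comm, mul_smul] at hsum
  have h0 : ∀ n : ℕ, (n.factorial : k) ≠ 0 := fun n => Nat.cast_ne_zero.2 n.factorial_ne_zero
  rw [smul_right_inj (h0 s)] at hsum
  rw [hsum, smul_smul, inv_mul_cancel₀ (h0 m), one_smul]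

/-- The version usable with `s = p - m`, where `p = m + s` is not definitional. -/
theorem sum_openSum_powersetCard_of_eq [CharZero k]
    (M : (n : ℕ) → MultilinearMap k (fun _ : Fin n => E) W)
    {m s p q : ℕ} (h : p = m + s) (d : Fin p → ℤ) (x y : Fin p → E) (e : Fin q → ℤ)
    (o : Fin q → E) :
    ∑ T ∈ Finset.powersetCard m Finset.univ, openSum (M (p + q)) d (T.piecewise x y) e o
      = (m.factorial : k)⁻¹ • ∑ σ : Equiv.Perm (Fin p), koszul d σ •
        nestedShuffle M (fun i : Fin m => d (σ ⟨i, by omega⟩)) (fun i : Fin m => x (σ ⟨i, by omega⟩))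
          (fun i : Fin s => d (σ ⟨m + i, by omega⟩)) (fun i : Fin s => y (σ ⟨m + i, by omega⟩))
          e o := by
  subst h
  exact sum_openSum_powersetCard M d x y e o

/-- Expansion of a symmetrized shuffle product of sums. -/
theorem openSum_add_eq_sum_nestedShuffle [CharZero k]
    (M : (n : ℕ) → MultilinearMap k (fun _ : Fin n => E) W)
    {p q : ℕ} (d : Fin p → ℤ) (x y : Fin p → E) (e : Fin q → ℤ) (o : Fin q → E) :
    openSum (M (p + q)) d (fun i => x i + y i) e o
      = ∑ m : Fin (p + 1), ((m : ℕ).factorial : k)⁻¹ • ∑ σ : Equiv.Perm (Fin p), koszul d σ •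
        nestedShuffle M (front (fun i => d (σ i)) m) (front (fun i => x (σ i)) m)
          (back (fun i => d (σ i)) m) (back (fun i => y (σ i)) m) e o := by
  -- Subsets are grouped by their size `m`, the number of letters taken from `x`.
  rw [openSum_add, ← Finset.powerset_univ, Finset.sum_powerset, Finset.card_univ,
    Fintype.card_fin, Finset.sum_range]
  exact Finset.sum_congr rfl fun m _ =>
    sum_openSum_powersetCard_of_eq M (by omega : p = m + (p - m)) d x y e o

theorem shuffles_zero (p : ℕ) : shuffles p 0 = {1} := by
  ext τ
  rw [mem_shuffles, Finset.mem_singleton]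
  constructor
  · rintro ⟨h, -⟩
    have h1 : Tuple.sort (id : Fin p → Fin p) = τ⁻¹ :=
      sort_eq_of_monotone Function.injective_id h.monotone
    have h2 : Tuple.sort (id : Fin p → Fin p) = 1 :=
      sort_eq_of_monotone Function.injective_id monotone_id
    rw [← inv_inj, ← h1, h2, inv_one]
  · rintro rfl
    exact ⟨fun _ _ h => h, fun i => i.elim0⟩

theorem append_zero_apply {γ : Type*} (x : Fin p → γ) (y : Fin 0 → γ) (j : Fin p) :
    Fin.append (m := p) (n := 0) x y j = x j :=
  Fin.append_left x y j

/-- Without open letters the only shuffle is the identity. This lets the closed relations be treated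
as the case `q = 0`. -/
theorem openSum_zero (M : MultilinearMap k (fun _ : Fin p => E) W) (e : Fin 0 → ℤ)
    (o : Fin 0 → E) :
    openSum (p := p) (q := 0) M d x e o
      = ∑ σ : Equiv.Perm (Fin p), koszul d σ • M fun i => x (σ i) := by
  rw [openSum_eq_sum_shuffles, shuffles_zero]
  simp only [Finset.sum_singleton, koszul_one, one_smul]
  exact Finset.sum_congr rfl fun σ _ => congrArg _ (congrArg M (funext fun j =>
    append_zero_apply (fun i => x (σ i)) o j))

end SymmetrizedShuffles

/-! ### The universal properties of the enveloping algebras -/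

section EnvelopeLift

variable {k : Type u} [Field k]

theorem apply_append {α : Type u₁} {β : Type u₂} (f : α → β) {p q : ℕ} (x : Fin p → α)
    (y : Fin q → α) (j : Fin (p + q)) :
    f (Fin.append x y j) = Fin.append (fun i => f (x i)) (fun i => f (y i)) j := by
  refine Fin.addCases (fun i => ?_) (fun i => ?_) j <;> simp

theorem AInfAlgebra.Hom.map_openSum {A : AInfAlgebra.{u, u₁} k} {B : AInfAlgebra.{u, u₂} k}
    (f : AInfAlgebra.Hom A B) {p q : ℕ} (d : Fin p → ℤ) (x : Fin p → A.carrier) (e : Fin q → ℤ)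
    (o : Fin q → A.carrier) :
    f (openSum (A.op (p + q)) d x e o)
      = openSum (B.op (p + q)) d (fun i => f (x i)) e fun j => f (o j) := by
  simp only [openSum, map_sum, map_zsmul]
  refine Finset.sum_congr rfl fun θ _ => ?_
  rw [f.map_op]
  congr 2
  exact funext fun j => apply_append f _ _ _

/-- Every word contains every letter of `o`. This settles the mixed relations wherever open
generators are sent to zero. -/
theorem openSum_eq_zero {E : Type v} [AddCommGroup E] [Module k E] {W : Type w} [AddCommGroup W]
    [Module k W] {p q : ℕ} (M : MultilinearMap k (fun _ : Fin (p + q) => E) W) (d : Fin p → ℤ)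
    (x : Fin p → E) (e : Fin q → ℤ) (o : Fin q → E) (j : Fin q) (h : o j = 0) :
    openSum M d x e o = 0 := by
  refine Finset.sum_eq_zero fun θ _ => ?_
  rw [M.map_coord_zero (θ⁻¹ (Fin.natAdd p j)) (by simp [h]), smul_zero]

/-- The composite of maps of degree zero. -/
def GradedHom.comp {V : GradedSpace.{u, u₁} k} {W : GradedSpace.{u, u₂} k}
    {X : GradedSpace.{u, u₃} k} (g : GradedHom W X) (f : GradedHom V W) : GradedHom V X where
  toLinearMap := g.toLinearMap ∘ₗ f.toLinearMap
  map_deg d x hx := g.map_deg d _ (f.map_deg d x hx)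

/-- The projection `V ⊕ W → V`. -/
def GradedSpace.fst (V : GradedSpace.{u, v} k) (W : GradedSpace.{u, w} k) :
    GradedHom (V.prod W) V where
  toLinearMap := LinearMap.fst k V W
  map_deg _ _ hx := hx.1

/-- The inclusion `V → V ⊕ W`. -/
def GradedSpace.inl (V : GradedSpace.{u, v} k) (W : GradedSpace.{u, w} k) :
    GradedHom V (V.prod W) where
  toLinearMap := LinearMap.inl k V W
  map_deg _ _ hx := ⟨hx, Submodule.zero_mem _⟩

variable {C : GradedSpace.{u, v} k} {O : GradedSpace.{u, w} k}

/-! ### The Lada–Markl enveloping algebra. -/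

namespace LInfStructure

variable (L : LInfStructure C)

/-- The canonical map to the enveloping algebra as a map of graded spaces. -/
noncomputable def ιHom : GradedHom C L.envelope.toGradedSpace :=
  ((freeAInf C).quotientHom _ ((freeAInf C).idealSpan_isIdeal L.Rel)).toGradedHom.comp (freeι C)

theorem ιHom_apply (c : C) : L.ιHom c = L.ι c := rfl

variable {L}

/-- The universal property of the enveloping algebra of an `L∞`-algebra. -/
noncomputable def lift (E : AInfAlgebra.{u, u₁} k) (f : GradedHom C E.toGradedSpace)
    (h : ∀ (p : ℕ) (d : Fin p → ℤ) (c : Fin p → C), 1 ≤ p → (∀ i, c i ∈ C.deg (d i)) →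
      ∑ σ : Equiv.Perm (Fin p), koszul d σ • E.op p (fun i => f (c (σ i))) = f (L.l p c)) :
    AInfAlgebra.Hom L.envelope E :=
  (freeLift E f).quotientLift (S := L.Rel) (by
    rintro _ ⟨p, d, c, hp, hc⟩
    rw [map_sub, map_sum, freeLift_ι, ← h p d c hp hc, sub_eq_zero]
    refine Finset.sum_congr rfl fun σ _ => ?_
    rw [map_zsmul, AInfAlgebra.Hom.map_op]
    simp only [freeLift_ι])

theorem lift_ι (E : AInfAlgebra.{u, u₁} k) (f : GradedHom C E.toGradedSpace) (h) (c : C) :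
    lift (L := L) E f h (L.ι c) = f c :=
  freeLift_ι E f c

theorem envelope_relation (p : ℕ) (d : Fin p → ℤ) (c : Fin p → C) (hp : 1 ≤ p)
    (hc : ∀ i, c i ∈ C.deg (d i)) :
    ∑ σ : Equiv.Perm (Fin p), koszul d σ • L.envelope.op p (fun i => L.ι (c (σ i)))
      = L.ι (L.l p c) := by
  have h := (OpAlgebra.quotientMk_eq_zero ((freeAInf C).idealSpan_isIdeal L.Rel)).2
    ((freeAInf C).subset_idealSpan _ (Rel.mk p d c hp hc))
  rw [map_sub, sub_eq_zero, map_sum] at h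
  refine Eq.trans (Finset.sum_congr rfl fun σ _ => ?_) h
  rw [map_zsmul]
  exact congrArg _ (OpAlgebra.quotient_op _ _ _)

theorem envelope_induction (N : Submodule k L.envelope.carrier) (hι : ∀ c, L.ι c ∈ N)
    (hop : ∀ n x, (∀ i, x i ∈ N) → L.envelope.op n x ∈ N) (x : L.envelope.carrier) : x ∈ N := by
  let Q := (freeAInf C).quotientHom _ ((freeAInf C).idealSpan_isIdeal L.Rel)
  obtain ⟨y, rfl⟩ := OpAlgebra.quotientMk_surjective ((freeAInf C).idealSpan_isIdeal L.Rel) x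
  refine freeAInf_induction (N.comap Q.toLinearMap) hι (fun n x hx => ?_) y
  change Q _ ∈ N
  rw [Q.map_op]
  exact hop n _ hx

end LInfStructure

/-! ### The enveloping algebra of an OCHA and its extension. -/

namespace OCHA

variable (H : OCHA C O)

/-- The canonical map to the enveloping algebra as a map of graded spaces. -/
noncomputable def ιHom : GradedHom (C.prod O) H.envelope.toGradedSpace :=
  ((freeAInf (C.prod O)).quotientHom _
    ((freeAInf (C.prod O)).idealSpan_isIdeal H.Rel)).toGradedHom.comp (freeι (C.prod O))

theorem ιHom_apply (x : C.prod O) : H.ιHom x = H.ι x := rfl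

variable {H}

/-- The universal property of the enveloping algebra of an open-closed homotopy algebra. -/
noncomputable def lift (E : AInfAlgebra.{u, u₁} k) (f : GradedHom (C.prod O) E.toGradedSpace)
    (hmixed : ∀ (p q : ℕ) (d : Fin p → ℤ) (c : Fin p → C) (e : Fin q → ℤ) (o : Fin q → O),
      1 ≤ q → (∀ i, c i ∈ C.deg (d i)) → (∀ i, o i ∈ O.deg (e i)) →
      openSum (E.op (p + q)) d (fun i => f ((c i, 0) : C × O)) e (fun j => f ((0, o j) : C × O))
        = f ((0, H.n p q c o) : C × O))
    (hclosed : ∀ (p : ℕ) (d : Fin p → ℤ) (c : Fin p → C), 1 ≤ p → (∀ i, c i ∈ C.deg (d i)) →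
      ∑ σ : Equiv.Perm (Fin p), koszul d σ • E.op p (fun i => f ((c (σ i), 0) : C × O))
        = f ((H.l p c, H.n p 0 c ![]) : C × O)) :
    AInfAlgebra.Hom H.envelope E :=
  (freeLift E f).quotientLift (S := H.Rel) (by
    rintro _ (⟨p, q, d, c, e, o, hq, hc, ho⟩ | ⟨p, d, c, hp, hc⟩)
    · rw [map_sub, sub_eq_zero]
      refine Eq.trans ?_ ((hmixed p q d c e o hq hc ho).trans (freeLift_ι E f _).symm)
      rw [openSum_eq_sum_shuffles, map_sum]
      refine Finset.sum_congr rfl fun σ _ => ?_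
      rw [map_zsmul, map_sum]
      congr 1
      refine Finset.sum_congr rfl fun τ _ => ?_
      rw [map_zsmul, AInfAlgebra.Hom.map_op]
      congr 2
      ext j
      refine (freeLift_ι E f _).trans ?_
      exact apply_append f _ _ _
    · rw [map_sub, sub_eq_zero, map_sum]
      refine Eq.trans (Finset.sum_congr rfl fun σ _ => ?_)
        ((hclosed p d c hp hc).trans (freeLift_ι E f _).symm)
      rw [map_zsmul, AInfAlgebra.Hom.map_op]
      exact congrArg _ (congrArg _ (funext fun i => freeLift_ι E f _)))

theorem lift_ι (E : AInfAlgebra.{u, u₁} k) (f : GradedHom (C.prod O) E.toGradedSpace) (h h')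
    (x : C.prod O) : lift (H := H) E f h h' (H.ι x) = f x :=
  freeLift_ι E f x

theorem envelope_relation_closed (p : ℕ) (d : Fin p → ℤ) (c : Fin p → C) (hp : 1 ≤ p)
    (hc : ∀ i, c i ∈ C.deg (d i)) :
    ∑ σ : Equiv.Perm (Fin p), koszul d σ • H.envelope.op p (fun i => H.ι ((c (σ i), 0) : C × O))
      = H.ι ((H.l p c, H.n p 0 c ![]) : C × O) := by
  have h := (OpAlgebra.quotientMk_eq_zero ((freeAInf (C.prod O)).idealSpan_isIdeal H.Rel)).2
    ((freeAInf (C.prod O)).subset_idealSpan _ (Rel.closed p d c hp hc))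
  rw [map_sub, sub_eq_zero, map_sum] at h
  refine Eq.trans (Finset.sum_congr rfl fun σ _ => ?_) h
  rw [map_zsmul]
  exact congrArg _ (OpAlgebra.quotient_op _ _ _)

theorem envelope_induction (N : Submodule k H.envelope.carrier) (hι : ∀ x, H.ι x ∈ N)
    (hop : ∀ n x, (∀ i, x i ∈ N) → H.envelope.op n x ∈ N) (x : H.envelope.carrier) : x ∈ N := by
  let Q := (freeAInf (C.prod O)).quotientHom _ ((freeAInf (C.prod O)).idealSpan_isIdeal H.Rel)
  obtain ⟨y, rfl⟩ := OpAlgebra.quotientMk_surjective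
    ((freeAInf (C.prod O)).idealSpan_isIdeal H.Rel) x
  refine freeAInf_induction (N.comap Q.toLinearMap) hι (fun n x hx => ?_) y
  change Q _ ∈ N
  rw [Q.map_op]
  exact hop n _ hx

/-- Linear `A∞`-morphisms on the enveloping algebra agree if they agree on generators. -/
theorem envelope_hom_ext {E : AInfAlgebra.{u, u₁} k} {φ ψ : AInfAlgebra.Hom H.envelope E}
    (h : ∀ x, φ (H.ι x) = ψ (H.ι x)) : φ = ψ := by
  refine AInfAlgebra.Hom.ext fun x => ?_
  refine envelope_induction (LinearMap.eqLocus φ.toLinearMap ψ.toLinearMap) h (fun n y hy => ?_) x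
  change φ _ = ψ _
  rw [φ.map_op, ψ.map_op]
  exact congrArg _ (funext hy)

variable (H)

theorem ι_add (x y : C.prod O) : H.ι (x + y) = H.ι x + H.ι y := by
  rw [← ιHom_apply, ← ιHom_apply, ← ιHom_apply, map_add]

theorem ι_open_mem (o : O) : H.ι ((0, o) : C × O) ∈ H.openIdeal :=
  H.envelope.subset_idealSpan _ ⟨o, rfl⟩

/-- The projection `C ⊕ O → C` followed by the canonical map to the enveloping algebra. -/
noncomputable def closedι : GradedHom (C.prod O) H.toLInfStructure.envelope.toGradedSpace :=
  H.toLInfStructure.ιHom.comp (GradedSpace.fst C O)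

theorem closedι_apply (c : C) (o : O) : H.closedι ((c, o) : C × O) = H.toLInfStructure.ι c := rfl

theorem closedι_open (o : O) : H.closedι ((0, o) : C × O) = 0 := by
  rw [closedι_apply, ← LInfStructure.ιHom_apply, map_zero]

/-- The projection `U∞(C, O) → U∞(C)`. -/
noncomputable def closedProj : AInfAlgebra.Hom H.envelope H.toLInfStructure.envelope :=
  lift _ H.closedι
    -- Both sides of a mixed relation vanish, since `q ≥ 1` supplies an open argument; a closed
    -- relation becomes that of `U∞(C)`.
    (fun _ _ _ _ _ _ hq _ _ => (openSum_eq_zero _ _ _ _ _ ⟨0, hq⟩ (H.closedι_open _)).trans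
      (H.closedι_open _).symm)
    (fun p d c hp hc => LInfStructure.envelope_relation p d c hp hc)

theorem closedProj_ι (c : C) (o : O) :
    H.closedProj (H.ι ((c, o) : C × O)) = H.toLInfStructure.ι c :=
  lift_ι _ _ _ _ _

theorem closedProj_surjective : Function.Surjective H.closedProj := by
  intro y
  refine LInfStructure.envelope_induction (LinearMap.range H.closedProj.toLinearMap)
    (fun c => ⟨_, H.closedProj_ι c 0⟩) (fun n x hx => ?_) y
  choose z hz using hx
  exact ⟨H.envelope.op n z, (H.closedProj.map_op n z).trans (congrArg _ (funext hz))⟩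

/-- The map `C → U∞(C, O) / ⟨O⟩`. -/
noncomputable def closedQuotientι :
    GradedHom C (H.envelope.quotient _ H.openIdeal_isIdeal).toGradedSpace :=
  (H.envelope.quotientHom _ H.openIdeal_isIdeal).toGradedHom.comp
    (H.ιHom.comp (GradedSpace.inl C O))

theorem quotientHom_ι (c : C) (o : O) :
    H.envelope.quotientHom _ H.openIdeal_isIdeal (H.ι ((c, o) : C × O)) = H.closedQuotientι c := by
  have h : ((c, o) : C × O) = (c, 0) + (0, o) := by simp
  have h' : H.ι ((c, o) : C × O) = H.ι ((c, 0) : C × O) + H.ι ((0, o) : C × O) :=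
    (congrArg H.ι h).trans (H.ι_add _ _)
  rw [h', map_add]
  have h0 : H.envelope.quotientHom _ H.openIdeal_isIdeal (H.ι ((0, o) : C × O)) = 0 :=
    (OpAlgebra.quotientMk_eq_zero H.openIdeal_isIdeal).2 (H.ι_open_mem o)
  rw [h0, add_zero]
  rfl

/-- The inverse `U∞(C) → U∞(C, O) / ⟨O⟩` of the isomorphism induced by the projection. -/
noncomputable def closedQuotientLift :
    AInfAlgebra.Hom H.toLInfStructure.envelope (H.envelope.quotient _ H.openIdeal_isIdeal) :=
  LInfStructure.lift _ H.closedQuotientι (fun p d c hp hc => by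
    -- The open component is arbitrary modulo `⟨O⟩`; choosing `n_{p,0}` makes the closed relation of
    -- `U∞(C, O)` applicable.
    rw [← H.quotientHom_ι (H.l p c) (H.n p 0 c ![]), ← envelope_relation_closed p d c hp hc,
      map_sum]
    refine Finset.sum_congr rfl fun σ _ => ?_
    rw [map_zsmul, AInfAlgebra.Hom.map_op]
    simp only [quotientHom_ι])

/-- The quotient map by `⟨O⟩` factors through the projection, since `closedQuotientLift` composed
with the projection agrees with it on generators. -/
theorem mem_openIdeal_of_closedProj_eq_zero (x : H.envelope.carrier) (hx : H.closedProj x = 0) :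
    x ∈ H.openIdeal := by
  have h : H.closedQuotientLift.comp H.closedProj
      = H.envelope.quotientHom _ H.openIdeal_isIdeal := by
    refine envelope_hom_ext fun y => ?_
    obtain ⟨c, o⟩ := y
    rw [H.quotientHom_ι c o]
    change H.closedQuotientLift (H.closedProj _) = _
    rw [H.closedProj_ι c o]
    exact LInfStructure.lift_ι _ _ _ c
  refine (OpAlgebra.quotientMk_eq_zero H.openIdeal_isIdeal).1 ?_
  change H.envelope.quotientHom _ H.openIdeal_isIdeal x = 0
  rw [← h]
  change H.closedQuotientLift (H.closedProj x) = 0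
  rw [hx, map_zero]

theorem map_eq_zero_of_mem_openIdeal {E : AInfAlgebra.{u, u₁} k} (φ : AInfAlgebra.Hom H.envelope E)
    (h : ∀ o : O, φ (H.ι ((0, o) : C × O)) = 0) (x : H.envelope.carrier) (hx : x ∈ H.openIdeal) :
    φ x = 0 := by
  refine OpAlgebra.idealSpan_le φ.ker_isIdeal ?_ hx
  rintro _ ⟨o, rfl⟩
  exact h o

theorem isExtension_closedProj : IsExtension H.openInclusion H.closedProj where
  injective := Subtype.val_injective
  exact y := by
    constructor
    · exact fun h => ⟨⟨y, H.mem_openIdeal_of_closedProj_eq_zero y h⟩, rfl⟩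
    · rintro ⟨x, rfl⟩
      refine H.map_eq_zero_of_mem_openIdeal _ (fun o => ?_) _ x.2
      rw [H.closedProj_ι 0 o, ← H.closedι_apply 0 o, H.closedι_open]
  surjective := H.closedProj_surjective

end OCHA

end EnvelopeLift

/-! ### Linear morphisms to the commutators and shuffles of an extension -/

section Commutators

variable {k : Type u} [Field k] {A : AInfAlgebra.{u, u₁} k} {E : AInfAlgebra.{u, u₂} k}
  {B : AInfAlgebra.{u, u₃} k} {i : AInfAlgebra.Hom A E} {π : AInfAlgebra.Hom E B}

namespace Splitting

variable (S : Splitting i π)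

theorem ocOperations_n_apply (m r : ℕ) (x : Fin m → B.carrier) (y : Fin r → A.carrier) :
    S.ocOperations.n m r x y
      = S.ret (symmShuffle (V := E.toGradedSpace) (E.op (m + r)) (fun j => S.sec (x j))
        fun j => i (y j)) := rfl

/-- The inner sums over `ρ` and `τ'` are the symmetrization and shuffling built into `n'_{m, s+q}`,
so only the outer shuffle of `y` with `o` remains. -/
theorem ret_nestedShuffle {m s q : ℕ} (d : Fin m → ℤ) (x : Fin m → B.carrier)
    (hx : ∀ j, x j ∈ B.deg (d j)) (d' : Fin s → ℤ) (y : Fin s → A.carrier)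
    (hy : ∀ j, y j ∈ A.deg (d' j)) (e : Fin q → ℤ) (o : Fin q → A.carrier)
    (ho : ∀ j, o j ∈ A.deg (e j)) :
    S.ret (nestedShuffle (fun n => E.op n) d (fun j => S.sec (x j)) d' (fun j => i (y j)) e
        fun j => i (o j))
      = ∑ τ ∈ shuffles s q, koszul (Fin.append d' e) τ •
        S.ocOperations.n m (s + q) x fun j => Fin.append y o (τ j) := by
  rw [nestedShuffle, map_sum]
  refine Finset.sum_congr rfl fun τ _ => ?_
  rw [map_zsmul, ocOperations_n_apply, symmShuffle_apply (V := E.toGradedSpace) _ d _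
    (fun j => S.sec.map_deg _ _ (hx j)) (fun j => Fin.append d' e (τ j)) _]
  · simp only [apply_append i.toLinearMap y o]
  · intro j
    refine i.map_deg _ _ ?_
    refine Fin.addCases (fun j => ?_) (fun j => ?_) (τ j)
    · simpa using hy j
    · simpa using ho j

theorem eq_incl_ret_add {e : E.carrier} {b : B.carrier} (h : π e = b) :
    e = S.sec b + i (S.ret e) := by
  rw [← h, add_comm, S.incl_ret_add_sec_proj]

/-- The splitting identities suffice: at `i a` the decomposition forces `sec (π (i a)) = 0`, and `π`
is a left inverse of `sec`. -/
theorem proj_incl (S : Splitting i π) (a : A.carrier) : π (i a) = 0 := by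
  have h := S.incl_ret_add_sec_proj (i a)
  rw [S.ret_incl, add_eq_left] at h
  rw [← S.proj_sec (π (i a)), h, map_zero]

variable {C : GradedSpace.{u, v₁} k} {O : GradedSpace.{u, v₂} k} {X : OCOperations C O}
  (f : LinearOCHAHom X S.ocOperations)

/-- `Splitting.total` as a map of graded spaces. -/
def totalHom : GradedHom (C.prod O) E.toGradedSpace where
  toLinearMap := S.sec.toLinearMap ∘ₗ f.g.toLinearMap ∘ₗ LinearMap.fst k C O +
    i.toLinearMap ∘ₗ (f.f₁₀.toLinearMap ∘ₗ LinearMap.fst k C O +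
      f.f₀₁.toLinearMap ∘ₗ LinearMap.snd k C O)
  map_deg _ _ hx := Submodule.add_mem _ (S.sec.map_deg _ _ (f.g.map_deg _ _ hx.1))
    (i.map_deg _ _ (Submodule.add_mem _ (f.f₁₀.map_deg _ _ hx.1) (f.f₀₁.map_deg _ _ hx.2)))

theorem totalHom_apply (c : C) (o : O) :
    S.totalHom f ((c, o) : C × O) = S.sec (f.g c) + i (f.f₁₀ c + f.f₀₁ o) := rfl

theorem totalHom_closed (c : C) :
    S.totalHom f ((c, 0) : C × O) = S.sec (f.g c) + i (f.f₁₀ c) := by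
  rw [totalHom_apply, map_zero, add_zero]

theorem totalHom_open (o : O) : S.totalHom f ((0, o) : C × O) = i (f.f₀₁ o) := by
  rw [totalHom_apply, map_zero, map_zero, map_zero, zero_add, zero_add]

theorem proj_totalHom (c : C) (o : O) : π (S.totalHom f ((c, o) : C × O)) = f.g c := by
  rw [totalHom_apply, map_add, S.proj_sec, S.proj_incl, add_zero]

/-- This covers both OCHA-morphism equations: for `q ≥ 1` the value is the right-hand side of
`map_n_open`, and for `q = 0` it reduces to that of `map_n_closed`. -/
theorem ret_openSum [CharZero k] (p q : ℕ) (d : Fin p → ℤ) (c : Fin p → C) (e : Fin q → ℤ)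
    (o : Fin q → O) (hc : ∀ j, c j ∈ C.deg (d j)) (ho : ∀ j, o j ∈ O.deg (e j)) :
    S.ret (openSum (E.op (p + q)) d (fun j => S.totalHom f ((c j, 0) : C × O)) e
        (fun j => S.totalHom f ((0, o j) : C × O)))
      = ∑ m : Fin (p + 1), ((m : ℕ).factorial : k)⁻¹ • ∑ σ : Equiv.Perm (Fin p), koszul d σ •
        ∑ τ ∈ shuffles (p - m) q, koszul (Fin.append (back (fun i => d (σ i)) m) e) τ •
          S.ocOperations.n m (p - m + q) (front (fun i => f.g (c (σ i))) m)
            (fun j => Fin.append (back (fun i => f.f₁₀ (c (σ i))) m) (fun i => f.f₀₁ (o i))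
              (τ j)) := by
  simp only [totalHom_closed, totalHom_open]
  rw [openSum_add_eq_sum_nestedShuffle fun n => E.op n, map_sum]
  refine Finset.sum_congr rfl fun m _ => ?_
  rw [map_smul, map_sum]
  congr 1
  refine Finset.sum_congr rfl fun σ _ => ?_
  rw [map_zsmul]
  congr 1
  exact S.ret_nestedShuffle (front (fun i => d (σ i)) m) (front (fun i => f.g (c (σ i))) m)
    (fun j => f.g.map_deg _ _ (hc _)) (back (fun i => d (σ i)) m)
    (back (fun i => f.f₁₀ (c (σ i))) m) (fun j => f.f₁₀.map_deg _ _ (hc _)) e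
    (fun j => f.f₀₁ (o j)) (fun j => f.f₀₁.map_deg _ _ (ho j))

theorem openSum_totalHom [CharZero k] (p q : ℕ) (d : Fin p → ℤ) (c : Fin p → C) (e : Fin q → ℤ)
    (o : Fin q → O) (hq : 1 ≤ q) (hc : ∀ j, c j ∈ C.deg (d j)) (ho : ∀ j, o j ∈ O.deg (e j)) :
    openSum (E.op (p + q)) d (fun j => S.totalHom f ((c j, 0) : C × O)) e
        (fun j => S.totalHom f ((0, o j) : C × O))
      = S.totalHom f ((0, X.n p q c o) : C × O) := by
  -- The `B`-component vanishes: open generators land in the image of `i`, which `π` kills.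
  have hπ : π (openSum (E.op (p + q)) d (fun j => S.totalHom f ((c j, 0) : C × O)) e
      (fun j => S.totalHom f ((0, o j) : C × O))) = 0 := by
    rw [π.map_openSum]
    refine openSum_eq_zero _ _ _ _ _ ⟨0, hq⟩ ?_
    rw [proj_totalHom, map_zero]
  rw [S.eq_incl_ret_add hπ, S.ret_openSum f p q d c e o hc ho, ← f.map_n_open p q d c e o hq hc ho,
    totalHom_open, map_zero, zero_add]

theorem sum_perm_totalHom [CharZero k] (p : ℕ) (d : Fin p → ℤ) (c : Fin p → C) (hp : 1 ≤ p)
    (hc : ∀ j, c j ∈ C.deg (d j)) :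
    ∑ σ : Equiv.Perm (Fin p), koszul d σ •
        E.op p (fun j => S.totalHom f ((c (σ j), 0) : C × O))
      = S.totalHom f ((X.l p c, X.n p 0 c ![]) : C × O) := by
  have hπ : π (∑ σ : Equiv.Perm (Fin p), koszul d σ •
        E.op p (fun j => S.totalHom f ((c (σ j), 0) : C × O))) = f.g (X.l p c) := by
    rw [f.map_l p c hp, map_sum]
    refine Eq.trans ?_ (symmetrize_apply (V := B.toGradedSpace) (B.op p) d _
      fun j => f.g.map_deg _ _ (hc j)).symm
    refine Finset.sum_congr rfl fun σ _ => ?_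
    rw [map_zsmul, π.map_op]
    simp only [proj_totalHom]
  have hret : S.ret (∑ σ : Equiv.Perm (Fin p), koszul d σ •
        E.op p (fun j => S.totalHom f ((c (σ j), 0) : C × O)))
      = f.f₁₀ (X.l p c) + f.f₀₁ (X.n p 0 c ![]) := by
    have h := S.ret_openSum f p 0 d c (fun j => j.elim0) (fun j => j.elim0) hc (fun j => j.elim0)
    rw [openSum_zero] at h
    refine h.trans ?_
    refine Eq.trans ?_ ((f.map_n_closed p d c hp hc).symm.trans (add_comm _ _))
    refine Finset.sum_congr rfl fun m _ => ?_
    congr 1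
    refine Finset.sum_congr rfl fun σ _ => ?_
    congr 1
    -- With `q = 0` the shuffle sum has one trivial term, which leaves the summand of
    -- `map_n_closed`.
    rw [shuffles_zero, Finset.sum_singleton, koszul_one, one_smul]
    exact congrArg _ (funext fun j => append_zero_apply _ _ j)
  rw [S.eq_incl_ret_add hπ, hret, totalHom_apply]

end Splitting

end Commutators

end OpenClosed

/-! ### The extension and its universal property. -/

theorem mainTheorem4 {k : Type u} [Field k] [CharZero k]
    (C : OpenClosed.GradedSpace.{u, v} k) (O : OpenClosed.GradedSpace.{u, w} k)
    (H : OpenClosed.OCHA C O) :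
    ∃ P : OpenClosed.AInfAlgebra.Hom H.envelope H.toLInfStructure.envelope,
      (∀ (c : C) (o : O), P (H.ι ((c, o) : C × O)) = H.toLInfStructure.ι c) ∧
      OpenClosed.IsExtension H.openInclusion P ∧
      ∀ (A : OpenClosed.AInfAlgebra.{u, u₁} k) (E : OpenClosed.AInfAlgebra.{u, u₂} k)
        (B : OpenClosed.AInfAlgebra.{u, u₃} k)
        (i : OpenClosed.AInfAlgebra.Hom A E) (π : OpenClosed.AInfAlgebra.Hom E B),
        OpenClosed.IsExtension i π →
        ∀ (S : OpenClosed.Splitting i π)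
          (f : OpenClosed.LinearOCHAHom H.toOperations S.ocOperations),
          (∃! φ : OpenClosed.AInfAlgebra.Hom H.envelope E, ∀ x, φ (H.ι x) = S.total f x) ∧
          ∃! Φ : OpenClosed.ExtensionHom H.openInclusion P i π,
            ∀ x, Φ.mid (H.ι x) = S.total f x := by
  refine ⟨H.closedProj, H.closedProj_ι, H.isExtension_closedProj, ?_⟩
  intro A E B i π hE S f
  let φ : OpenClosed.AInfAlgebra.Hom H.envelope E :=
    OpenClosed.OCHA.lift E (S.totalHom f) (S.openSum_totalHom f) (S.sum_perm_totalHom f)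
  have hφ : ∀ x, φ (H.ι x) = S.total f x := OpenClosed.OCHA.lift_ι E _ _ _
  have huniq : ∀ ψ : OpenClosed.AInfAlgebra.Hom H.envelope E,
      (∀ x, ψ (H.ι x) = S.total f x) → ψ = φ := fun ψ hψ =>
    OpenClosed.OCHA.envelope_hom_ext fun x => (hψ x).trans (hφ x).symm
  refine ⟨⟨φ, hφ, huniq⟩, ?_⟩
  -- It suffices to test `π ∘ φ` on the open generators, where its value is `g 0 = 0`. This yields
  -- both outer maps: `φ` sends `⟨O⟩` into `ker π = im i`, and `π ∘ φ` vanishes on the kernel of the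
  -- projection.
  have hker : ∀ x ∈ H.openIdeal, π (φ x) = 0 :=
    H.map_eq_zero_of_mem_openIdeal (π.comp φ) fun o => by
      refine (congrArg π (hφ _)).trans ?_
      exact (S.proj_totalHom f 0 o).trans (map_zero _)
  let Φ : OpenClosed.ExtensionHom H.openInclusion H.closedProj i π :=
    { left := OpenClosed.AInfAlgebra.Hom.factor i hE.injective (φ.comp H.openInclusion)
        (fun a => (hE.exact _).1 (hker _ a.2))
        (i.toGradedHom.mem_deg_of_injective hE.injective)
      mid := φ
      right := OpenClosed.AInfAlgebra.Hom.descend H.closedProj H.closedProj_surjective (π.comp φ)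
        fun a ha => hker a (H.mem_openIdeal_of_closedProj_eq_zero a ha)
      comm_left := fun a =>
        (OpenClosed.AInfAlgebra.Hom.factor_spec i _ (φ.comp H.openInclusion) _ _ a).symm
      comm_right := fun e => OpenClosed.AInfAlgebra.Hom.descend_apply _ _ (π.comp φ) _ e }
  refine ⟨Φ, hφ, ?_⟩
  rintro ⟨l, m, r, hl, hr⟩ hm
  obtain rfl : m = φ := huniq m hm
  -- Once the middle map is fixed, injectivity of `i` determines the left map and surjectivity of
  -- the projection the right one.
  have h1 : l = Φ.left := OpenClosed.AInfAlgebra.Hom.ext fun a =>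
    hE.injective ((hl a).symm.trans (Φ.comm_left a))
  have h2 : r = Φ.right := OpenClosed.AInfAlgebra.Hom.ext fun y => by
    obtain ⟨x, rfl⟩ := H.closedProj_surjective y
    exact (hr x).trans (Φ.comm_right x).symm
  subst h1 h2
  rfl
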